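/- Let $d=m+n$ with $m,n\ge 1$, and write $\mathbf x=(\mathbf x_1,\mathbf x_2)\in\mathbb R^m\times\mathbb R^n=\mathbb R^d$. Let $f:\mathbb R^d\to\mathbb R$ be twice differentiable and bounded below, with infimum $f^*$. Assume, for all arguments, $\|\nabla f(\mathbf x)-\nabla f(\mathbf y)\|\le L\|\mathbf x-\mathbf y\|$; $\|\nabla^2 f(\mathbf x)-\nabla^2 f(\mathbf y)\|\le\rho\|\mathbf x-\mathbf y\|$ with $\rho>0$; and that for $k=1,2$ the partial gradient $\nabla_k f$ is Lipschitz with constant $L_k$ in the block $\mathbf x_k$ (other block fixed) and with constant $\widetilde L_k$ in the other block ($\mathbf x_k$ fixed). Put $L_{\max}=\max\{L_1,L_2,\widetilde L_1,\widetilde L_2\}$ and assume $L_{\max}\le L$. For $\mathbf x^{(0)}\in\mathbb R^d$, $\epsilon,\delta,c>0$ let $\Delta_f=f(\mathbf x^{(0)})-f^*$, $\gamma=(L_{\max}\rho\epsilon)^{1/3}$, and $$\mathcal P=1+\frac{L\log(2d)}{L_{\max}},\quad \ell=\log\frac{\mathcal P^2 d L_{\max}^{5/3}\Delta_f}{c^5\rho^{1/3}\epsilon^{7/3}\delta},\quad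 \chi=6\max\{\ell,4\},\quad \nu=\frac{L_{\max}}{c},$$ $$r=\frac{c^3\epsilon}{\chi^3L_{\max}\mathcal P},\quad g_{\rm th}=\frac{c^2\epsilon}{\chi^3\mathcal P},\quad f_{\rm th}=\frac{c^5\epsilon^2}{L_{\max}\chi^6\mathcal P^2},\quad t_{\rm th}=\left\lceil\frac{L_{\max}\chi}{c^2\gamma}\right\rceil .$$ (If $\Delta_f=0$, then $\chi=24$ and $\max\{\ell,1\}=1$.) For a point $\mathbf x$ let $A(\mathbf x)=(\mathbf x_1^+,\mathbf x_2^+)$, where $\mathbf x_1^+=\arg\min_{\mathbf z}f(\mathbf z,\mathbf x_2)+\frac\nu2\|\mathbf z-\mathbf x_1\|^2$ and $\mathbf x_2^+=\arg\min_{\mathbf z}f(\mathbf x_1^+,\mathbf z)+\frac\nu2\|\mathbf z-\mathbf x_2\|^2$. The perturbed alternating proximal point method (PA-PP) performs the following for $t=0,1,2,\dots$. (1) If $\|A(\mathbf x^{(t)})-\mathbf x^{(t)}\|\le g_{\rm th}/\nu$ and either no perturbation has been made so far or $t-t_{\rm p}>t_{\rm th}$, set $\widetilde{\mathbf x}\leftarrow\mathbf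 x^{(t)}$, $t_{\rm p}\leftarrow t$ and $\mathbf x^{(t)}\leftarrow\widetilde{\mathbf x}+\xi^{(t)}$, where $\xi^{(0)},\xi^{(1)},\dots$ are independent and uniformly distributed on the ball of radius $r$ about $0$. (2) If a perturbation has been made, $t-t_{\rm p}=t_{\rm th}$ and $f(\mathbf x^{(t)})-f(\widetilde{\mathbf x})>-f_{\rm th}$, stop and return $\widetilde{\mathbf x}$. (3) Otherwise set $\mathbf x^{(t+1)}=A(\mathbf x^{(t)})$. Call $\mathbf x$ an $(\epsilon,\gamma)$-second-order stationary point if $\|\nabla f(\mathbf x)\|\le\epsilon$ and $\lambda_{\min}(\nabla^2f(\mathbf x))\ge-\gamma$. There are absolute constants $c_{\max}>0$ and $C>0$ such that for all such $m,n,f,L,L_k,\widetilde L_k,\rho,\mathbf x^{(0)}$, every $\delta\in(0,1]$, every $0<\epsilon\le L_{\max}^2/\rho$ and every $0<c\le c_{\max}$, the following holds with probability at least $1-\delta$. PA-PP stops and returns an $(\epsilon,(L_{\max}\rho\epsilon)^{1/3})$-second-order stationary point $\widetilde{\mathbf x}$. This point is the iterate with index $$t_{\rm p}\le\frac{C}{c^{7}}\,\frac{L_{\max}^{5/3}\mathcal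 P^2\Delta_f}{\rho^{1/3}\epsilon^{7/3}}\,\max\{\ell,1\}^7,$$ and the method stops at iteration $T=t_{\rm p}+t_{\rm th}$. Moreover, if $\mathbf x^{(0)}$ is not itself an $(\epsilon,(L_{\max}\rho\epsilon)^{1/3})$-second-order stationary point, then the total number $T$ of iterations satisfies $$T\le\frac{C}{c^{7}}\,\frac{L_{\max}^{5/3}\mathcal P^2\Delta_f}{\rho^{1/3}\epsilon^{7/3}}\,\log^7\!\left(\frac{\mathcal P^2 d L_{\max}^{5/3}\Delta_f}{c^5\rho^{1/3}\epsilon^{7/3}\delta}\right).$$ -/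

import Mathlib

open MeasureTheory ProbabilityTheory
open scoped Gradient

noncomputable section

namespace PAPP

/-- `ℝ^d` with `d = m + n`, split into a first block of dimension `m` and a second block of
dimension `n`, with the Euclidean norm. -/
abbrev Vec (m n : ℕ) : Type := EuclideanSpace ℝ (Fin m ⊕ Fin n)

variable {m n : ℕ}

/-- The first block `x₁` of `x`. -/
def blk₁ (x : Vec m n) : EuclideanSpace ℝ (Fin m) := WithLp.toLp 2 (fun i => x (Sum.inl i))

/-- The second block `x₂` of `x`. -/
def blk₂ (x : Vec m n) : EuclideanSpace ℝ (Fin n) := WithLp.toLp 2 (fun i => x (Sum.inr i))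

/-- The vector with blocks `(x₁, x₂)`. -/
def join (x₁ : EuclideanSpace ℝ (Fin m)) (x₂ : EuclideanSpace ℝ (Fin n)) : Vec m n :=
  WithLp.toLp 2 (Sum.elim (fun i => x₁ i) (fun j => x₂ j))

/-- The partial gradient with respect to the first block (the first block of the gradient). -/
def grad₁ (f : Vec m n → ℝ) (x : Vec m n) : EuclideanSpace ℝ (Fin m) := blk₁ (∇ f x)

/-- The partial gradient with respect to the second block. -/
def grad₂ (f : Vec m n → ℝ) (x : Vec m n) : EuclideanSpace ℝ (Fin n) := blk₂ (∇ f x)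

/-- The Hessian `∇² f(x)` as a linear operator. -/
def hess (f : Vec m n → ℝ) (x : Vec m n) : Vec m n →L[ℝ] Vec m n := fderiv ℝ (∇ f) x

/-- The smallest (real) eigenvalue of an operator on `ℝ^d`. -/
def lambdaMin (A : Vec m n →L[ℝ] Vec m n) : ℝ :=
  sInf {μ : ℝ | Module.End.HasEigenvalue (A : Vec m n →ₗ[ℝ] Vec m n) μ}

/-- `x` is an `(ε, γ)`-second-order stationary point of `f`. -/
def IsSS2 (f : Vec m n → ℝ) (ε γ : ℝ) (x : Vec m n) : Prop :=
  ‖∇ f x‖ ≤ ε ∧ -γ ≤ lambdaMin (hess f x)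

/-- `f` is twice differentiable, `L`-smooth, block-wise smooth with gradient Lipschitz constants
`L₁, L₂` (own block) and `K₁, K₂` (other block), and `ρ`-Hessian Lipschitz. -/
structure Assumption (f : Vec m n → ℝ) (L L₁ L₂ K₁ K₂ ρ : ℝ) : Prop where
  diff : Differentiable ℝ f
  diff_grad : Differentiable ℝ (∇ f)
  smooth : ∀ x y, ‖∇ f x - ∇ f y‖ ≤ L * ‖x - y‖
  block₁ : ∀ x₁ x₁' x₂, ‖grad₁ f (join x₁ x₂) - grad₁ f (join x₁' x₂)‖ ≤ L₁ * ‖x₁ - x₁'‖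
  block₂ : ∀ x₁ x₂ x₂', ‖grad₂ f (join x₁ x₂) - grad₂ f (join x₁ x₂')‖ ≤ L₂ * ‖x₂ - x₂'‖
  cross₁ : ∀ x₁ x₂ x₂', ‖grad₁ f (join x₁ x₂) - grad₁ f (join x₁ x₂')‖ ≤ K₁ * ‖x₂ - x₂'‖
  cross₂ : ∀ x₁ x₁' x₂, ‖grad₂ f (join x₁ x₂) - grad₂ f (join x₁' x₂)‖ ≤ K₂ * ‖x₁ - x₁'‖
  hessLip : ∀ x y, ‖hess f x - hess f y‖ ≤ ρ * ‖x - y‖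

/-- `L_max = max {L₁, L₂, K₁, K₂}`. -/
def Lmax (L₁ L₂ K₁ K₂ : ℝ) : ℝ := max (max L₁ L₂) (max K₁ K₂)

/-- `Δ_f = f(x⁰) - f*`, with `f*` the global minimum value (infimum) of `f`. -/
def gap (f : Vec m n → ℝ) (x₀ : Vec m n) : ℝ := f x₀ - ⨅ x, f x

/-! ### The parameters of the algorithm

`M` stands for `L_max`, `Δ` for `Δ_f`, `d` for the total dimension. -/

/-- `𝒫 = 1 + L log(2d) / L_max`. -/
def calP (d : ℕ) (L M : ℝ) : ℝ := 1 + L * Real.log (2 * (d : ℝ)) / M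

/-- `L_max^{5/3} 𝒫² Δ_f / (ρ^{1/3} ε^{7/3})`. -/
def rate (d : ℕ) (L M ρ ε Δ : ℝ) : ℝ :=
  M ^ (5 / 3 : ℝ) * calP d L M ^ 2 * Δ / (ρ ^ (1 / 3 : ℝ) * ε ^ (7 / 3 : ℝ))

/-- `log (𝒫² d L_max^{5/3} Δ_f / (c⁵ ρ^{1/3} ε^{7/3} δ))`. -/
def logTerm (d : ℕ) (L M ρ ε δ Δ c : ℝ) : ℝ :=
  Real.log (calP d L M ^ 2 * d * M ^ (5 / 3 : ℝ) * Δ /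
    (c ^ 5 * ρ ^ (1 / 3 : ℝ) * ε ^ (7 / 3 : ℝ) * δ))

/-- `χ = 6 max {log (...), 4}`. -/
def chi (d : ℕ) (L M ρ ε δ Δ c : ℝ) : ℝ := 6 * max (logTerm d L M ρ ε δ Δ c) 4

/-- The curvature tolerance `γ = (L_max ρ ε)^{1/3}`. -/
def gam (M ρ ε : ℝ) : ℝ := (M * ρ * ε) ^ (1 / 3 : ℝ)

/-- The proximal penalty `ν = L_max / c`. -/
def nu (M c : ℝ) : ℝ := M / c

/-- The perturbation radius `r = c³ ε / (χ³ L_max 𝒫)`. -/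
def radius (d : ℕ) (L M ρ ε δ Δ c : ℝ) : ℝ :=
  c ^ 3 * ε / (chi d L M ρ ε δ Δ c ^ 3 * M * calP d L M)

/-- `g_th = c² ε / (χ³ 𝒫)`. -/
def gth (d : ℕ) (L M ρ ε δ Δ c : ℝ) : ℝ :=
  c ^ 2 * ε / (chi d L M ρ ε δ Δ c ^ 3 * calP d L M)

/-- `f_th = c⁵ ε² / (L_max χ⁶ 𝒫²)`. -/
def fth (d : ℕ) (L M ρ ε δ Δ c : ℝ) : ℝ :=
  c ^ 5 * ε ^ 2 / (M * chi d L M ρ ε δ Δ c ^ 6 * calP d L M ^ 2)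

/-- `t_th = L_max χ / (c² (L_max ρ ε)^{1/3})`, rounded up to an integer. -/
def tth (d : ℕ) (L M ρ ε δ Δ c : ℝ) : ℕ :=
  ⌈M * chi d L M ρ ε δ Δ c / (c ^ 2 * gam M ρ ε)⌉₊

/-! ### The algorithm -/

/-- A global minimizer of `F` (an arbitrary point if there is none). -/
def argmin {α : Type*} [Nonempty α] (F : α → ℝ) : α :=
  Classical.epsilon (fun z => ∀ w, F z ≤ F w)

/-- First block update: `argmin_z f(z, x₂) + (ν/2) ‖z - x₁‖²`. -/
def prox₁ (f : Vec m n → ℝ) (ν : ℝ) (x : Vec m n) : EuclideanSpace ℝ (Fin m) :=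
  argmin (fun z => f (join z (blk₂ x)) + ν / 2 * ‖z - blk₁ x‖ ^ 2)

/-- Second block update, with the first block already updated:
`argmin_z f(x₁⁺, z) + (ν/2) ‖z - x₂‖²`. -/
def prox₂ (f : Vec m n → ℝ) (ν : ℝ) (x : Vec m n) : EuclideanSpace ℝ (Fin n) :=
  argmin (fun z => f (join (prox₁ f ν x) z) + ν / 2 * ‖z - blk₂ x‖ ^ 2)

/-- One full sweep of the alternating proximal point method. -/
def appStep (f : Vec m n → ℝ) (ν : ℝ) (x : Vec m n) : Vec m n :=
  join (prox₁ f ν x) (prox₂ f ν x)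

/-- State of the algorithm: either still running, with the current iterate and, if there has been
a perturbation, the time `t_p` of the last one and the iterate just before it; or stopped, having
returned the iterate `xp`, which was the iterate at the time `tp` of the last perturbation. -/
inductive State (m n : ℕ) : Type
  | running (x : Vec m n) (last : Option (ℕ × Vec m n)) : State m n
  | returned (tp : ℕ) (xp : Vec m n) : State m n

open Classical in
/-- Iteration `t` of the perturbed alternating proximal point method with penalty `ν`, thresholds
`g`, `φ`, `τ` and noise sequence `ξ`. -/
def iteration (f : Vec m n → ℝ) (ν g φ : ℝ) (τ : ℕ) (ξ : ℕ → Vec m n) (t : ℕ) :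
    State m n → State m n
  | .returned tp xp => .returned tp xp
  | .running x last =>
      -- perturb when the next step would be short and no perturbation is recent
      let perturb : Prop := ‖appStep f ν x - x‖ ≤ g / ν ∧ ∀ q ∈ last, q.1 + τ < t
      let last' : Option (ℕ × Vec m n) := if perturb then some (t, x) else last
      let x' : Vec m n := if perturb then x + ξ t else x
      match last' with
      | none => .running (appStep f ν x') none
      | some (tp, xp) =>
          if t = tp + τ ∧ f x' - f xp > -φ then .returned tp xp
          else .running (appStep f ν x') (some (tp, xp))

/-- The state before iteration `t`, started at `x₀` with no earlier perturbation. -/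
def run (f : Vec m n → ℝ) (ν g φ : ℝ) (τ : ℕ) (ξ : ℕ → Vec m n) (x₀ : Vec m n) : ℕ → State m n
  | 0 => .running x₀ none
  | t + 1 => iteration f ν g φ τ ξ t (run f ν g φ τ ξ x₀ t)

/-- The algorithm stops in iteration `T` (that is, after exactly `T` full sweeps) and returns
`xp`, the iterate with index `tp`. -/
def ReturnsAt (f : Vec m n → ℝ) (ν g φ : ℝ) (τ : ℕ) (ξ : ℕ → Vec m n) (x₀ : Vec m n)
    (T tp : ℕ) (xp : Vec m n) : Prop :=
  (∃ x last, run f ν g φ τ ξ x₀ T = .running x last) ∧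
    run f ν g φ τ ξ x₀ (T + 1) = .returned tp xp

end PAPP

end

/-! Stopping is an energy argument. A sweep lowers `f` by at least `ν/2` times its squared length,
so a sweep longer than `g/ν` gains `g²/(2ν)`. A perturbation phase that does not end in a return
takes `τ + 1` iterations and gains at least `φ`. With `κ = φ/(τ+1)` the gain is at least `κ` per
iteration on average, and since `f` is bounded below the method stops with `tp * κ ≤ Δ`
(`exists_returnsAt`). The returned point has a short sweep, hence a small gradient (`norm_grad_le`).
It can only be bad if it has curvature below `-γ` and its perturbation did not escape.

Such perturbations are rare. Suppose two stuck perturbations of `z` differ by `α • e`, with `e` a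
direction of negative curvature. Both trajectories stay within some `S` of `z`
(`norm_iterate_sub_le`), so up to errors of order `ρS` their difference follows the alternating
proximal iteration of the quadratic form of the Hessian at `z`. Dividing its blocks at time `t` by
`s^(2t)` and `s^(2t+1)`, where `s² = 1 + γ/(2ν)`, gives the same kind of iteration for another
symmetric form (`rescaled_step`). The energy of that form starts negative and keeps half of its size
despite the errors (`half_le_of_increments`), so the rescaled difference cannot shrink away and the
true one grows like `s^(2t)` (`growth_le`). Confinement to radius `S` then forces `α < r/D`
(`stuck_thin`). With `D = d * K`, a set this thin fills at most the fraction `3/K` of the ball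
(`volume_le_of_thin`). The noise at time `t` is independent of the iterate, so a union bound over `N
+ 1` times finishes (`measure_fail_le`).

The growth `exp(χ/(2c))` must beat `D` and `M/γ`. Both are polynomially bounded in `χ`, `1/c` and
the argument `G` of the logarithm, and `G ≤ exp(χ/6)` (`exp_growth`). For `M/γ` this holds because
negative curvature at a point not above `x₀` bounds `Δ` from below. -/

namespace PAPP

open scoped RealInnerProductSpace

/-! ### Block decomposition of the Euclidean space. -/

section Blocks

variable {m n : ℕ}

@[simp] lemma blk₁_join (u : EuclideanSpace ℝ (Fin m)) (v : EuclideanSpace ℝ (Fin n)) :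
    blk₁ (join u v) = u := rfl

@[simp] lemma blk₂_join (u : EuclideanSpace ℝ (Fin m)) (v : EuclideanSpace ℝ (Fin n)) :
    blk₂ (join u v) = v := rfl

@[simp] lemma join_blk (x : Vec m n) : join (blk₁ x) (blk₂ x) = x := by
  ext i; rcases i with i | i <;> rfl

@[simp] lemma blk₁_add (x y : Vec m n) : blk₁ (x + y) = blk₁ x + blk₁ y := rfl
@[simp] lemma blk₂_add (x y : Vec m n) : blk₂ (x + y) = blk₂ x + blk₂ y := rfl
@[simp] lemma blk₁_sub (x y : Vec m n) : blk₁ (x - y) = blk₁ x - blk₁ y := rfl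
@[simp] lemma blk₂_sub (x y : Vec m n) : blk₂ (x - y) = blk₂ x - blk₂ y := rfl
@[simp] lemma blk₁_smul (a : ℝ) (x : Vec m n) : blk₁ (a • x) = a • blk₁ x := rfl
@[simp] lemma blk₂_smul (a : ℝ) (x : Vec m n) : blk₂ (a • x) = a • blk₂ x := rfl

lemma inner_eq_blk (x y : Vec m n) : ⟪x, y⟫ = ⟪blk₁ x, blk₁ y⟫ + ⟪blk₂ x, blk₂ y⟫ := by
  simp only [PiLp.inner_apply, Fintype.sum_sum_type]
  rfl

lemma norm_sq_eq_blk (x : Vec m n) : ‖x‖ ^ 2 = ‖blk₁ x‖ ^ 2 + ‖blk₂ x‖ ^ 2 := by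
  simp only [← real_inner_self_eq_norm_sq, inner_eq_blk]

lemma norm_blk₁_le (x : Vec m n) : ‖blk₁ x‖ ≤ ‖x‖ := by
  refine le_of_sq_le_sq ?_ (norm_nonneg _)
  rw [norm_sq_eq_blk x]; nlinarith [sq_nonneg ‖blk₂ x‖]

lemma norm_blk₂_le (x : Vec m n) : ‖blk₂ x‖ ≤ ‖x‖ := by
  refine le_of_sq_le_sq ?_ (norm_nonneg _)
  rw [norm_sq_eq_blk x]; nlinarith [sq_nonneg ‖blk₁ x‖]

lemma norm_le_blk (x : Vec m n) : ‖x‖ ≤ ‖blk₁ x‖ + ‖blk₂ x‖ := by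
  refine le_of_sq_le_sq ?_ (by positivity)
  rw [norm_sq_eq_blk x]
  nlinarith [mul_nonneg (norm_nonneg (blk₁ x)) (norm_nonneg (blk₂ x))]

end Blocks

/-! ### Consequences of block smoothness and of the Lipschitz Hessian. -/

section Smooth

variable {m n : ℕ}

/-- Twice differentiable functions whose partial gradients are `M`-Lipschitz in each block
and whose Hessian is `ρ`-Lipschitz. -/
structure BlockSmooth (f : Vec m n → ℝ) (M ρ : ℝ) : Prop where
  pos : 0 < M
  rho_pos : 0 < ρ
  diff : Differentiable ℝ f
  diff_grad : Differentiable ℝ (∇ f)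
  lip₁ : ∀ x y, ‖grad₁ f x - grad₁ f y‖ ≤ M * (‖blk₁ x - blk₁ y‖ + ‖blk₂ x - blk₂ y‖)
  lip₂ : ∀ x y, ‖grad₂ f x - grad₂ f y‖ ≤ M * (‖blk₁ x - blk₁ y‖ + ‖blk₂ x - blk₂ y‖)
  hessLip : ∀ x y, ‖hess f x - hess f y‖ ≤ ρ * ‖x - y‖

variable {f : Vec m n → ℝ} {M ρ : ℝ}

/-- Passing through the intermediate point `(y₁, x₂)` changes one block at a time, so each
assumption applies to one leg. -/
lemma Assumption.blockSmooth {L L₁ L₂ K₁ K₂ : ℝ}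
    (h : Assumption f L L₁ L₂ K₁ K₂ ρ) (hρ : 0 < ρ) (hM : M = Lmax L₁ L₂ K₁ K₂) (hpos : 0 < M) :
    BlockSmooth f M ρ where
  pos := hpos
  rho_pos := hρ
  diff := h.diff
  diff_grad := h.diff_grad
  hessLip := h.hessLip
  lip₁ x y := by
    have h1 := h.block₁ (blk₁ x) (blk₁ y) (blk₂ x)
    have h2 := h.cross₁ (blk₁ y) (blk₂ x) (blk₂ y)
    have e1 : L₁ ≤ M := by rw [hM]; simp [Lmax]
    have e2 : K₁ ≤ M := by rw [hM]; simp [Lmax]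
    simp only [join_blk] at h1 h2
    have h3 := norm_sub_le_norm_sub_add_norm_sub (grad₁ f x)
      (grad₁ f (join (blk₁ y) (blk₂ x))) (grad₁ f y)
    nlinarith [mul_le_mul_of_nonneg_right e1 (norm_nonneg (blk₁ x - blk₁ y)),
      mul_le_mul_of_nonneg_right e2 (norm_nonneg (blk₂ x - blk₂ y))]
  lip₂ x y := by
    have h1 := h.block₂ (blk₁ y) (blk₂ x) (blk₂ y)
    have h2 := h.cross₂ (blk₁ x) (blk₁ y) (blk₂ x)
    have e1 : L₂ ≤ M := by rw [hM]; simp [Lmax]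
    have e2 : K₂ ≤ M := by rw [hM]; simp [Lmax]
    simp only [join_blk] at h1 h2
    have h3 := norm_sub_le_norm_sub_add_norm_sub (grad₂ f x)
      (grad₂ f (join (blk₁ y) (blk₂ x))) (grad₂ f y)
    nlinarith [mul_le_mul_of_nonneg_right e2 (norm_nonneg (blk₁ x - blk₁ y)),
      mul_le_mul_of_nonneg_right e1 (norm_nonneg (blk₂ x - blk₂ y))]

namespace BlockSmooth

/-- Each gradient block changes by at most `M (a + b)`, and `2 (a + b)² ≤ 4 (a² + b²)`. -/
lemma norm_grad_sub_le (hf : BlockSmooth f M ρ) (x y : Vec m n) :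
    ‖∇ f x - ∇ f y‖ ≤ 2 * M * ‖x - y‖ := by
  have hM := hf.pos
  refine le_of_sq_le_sq ?_ (by positivity)
  rw [norm_sq_eq_blk, mul_pow, norm_sq_eq_blk (x - y)]
  have h1 := hf.lip₁ x y
  have h2 := hf.lip₂ x y
  rw [grad₁, grad₁, ← blk₁_sub] at h1
  rw [grad₂, grad₂, ← blk₂_sub] at h2
  rw [blk₁_sub x y, blk₂_sub x y]
  have h1' := pow_le_pow_left₀ (norm_nonneg _) h1 2
  have h2' := pow_le_pow_left₀ (norm_nonneg _) h2 2
  nlinarith [sq_nonneg (M * (‖blk₁ x - blk₁ y‖ - ‖blk₂ x - blk₂ y‖))]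

lemma norm_hess_le (hf : BlockSmooth f M ρ) (x : Vec m n) : ‖hess f x‖ ≤ 2 * M := by
  have hM := hf.pos
  exact norm_fderiv_le_of_lip' ℝ (by positivity)
    (Filter.Eventually.of_forall fun y => hf.norm_grad_sub_le y x)

lemma abs_inner_hess_le (hf : BlockSmooth f M ρ) (x u v : Vec m n) :
    |⟪u, hess f x v⟫| ≤ 2 * M * ‖u‖ * ‖v‖ := by
  have h1 := abs_real_inner_le_norm u (hess f x v)
  have h2 := (hess f x).le_of_opNorm_le (hf.norm_hess_le x) v
  nlinarith [norm_nonneg u]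

lemma hasDerivAt_ray (hd : Differentiable ℝ f) (x h : Vec m n) (t : ℝ) :
    HasDerivAt (fun t : ℝ => f (x + t • h)) ⟪∇ f (x + t • h), h⟫ t := by
  have h1 : HasDerivAt (fun t : ℝ => x + t • h) h t := by
    simpa using ((hasDerivAt_id t).smul_const h).const_add x
  have h2 := (hd (x + t • h)).hasFDerivAt.comp_hasDerivAt t h1
  rwa [inner_gradient_left]

/-- Subtracting a primitive of the quadratic bound leaves an antitone function on `[0, 1]`. The case
`c = 0` gives the descent lemma, the cubic case the gain along negative curvature. -/
lemma le_of_ray (hd : Differentiable ℝ f) (x h : Vec m n) {a b c : ℝ}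
    (hb : ∀ t, 0 ≤ t → ⟪∇ f (x + t • h), h⟫ ≤ a + b * t + c * t ^ 2) :
    f (x + h) ≤ f x + a + b / 2 + c / 3 := by
  let g : ℝ → ℝ := fun t => f (x + t • h) - (a * t + b / 2 * t ^ 2 + c / 3 * t ^ 3)
  have hg : ∀ t, HasDerivAt g (⟪∇ f (x + t • h), h⟫ - (a + b * t + c * t ^ 2)) t := by
    intro t
    have h2 : HasDerivAt (fun t : ℝ => a * t + b / 2 * t ^ 2 + c / 3 * t ^ 3)
        (a + b * t + c * t ^ 2) t := by
      have := (((hasDerivAt_id t).const_mul a).add ((hasDerivAt_pow 2 t).const_mul (b / 2))).add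
        ((hasDerivAt_pow 3 t).const_mul (c / 3))
      refine this.congr_deriv ?_
      norm_num; ring
    exact (hasDerivAt_ray hd x h t).sub h2
  have hanti : AntitoneOn g (Set.Icc 0 1) := by
    refine antitoneOn_of_deriv_nonpos (convex_Icc 0 1)
      (fun t _ => (hg t).continuousAt.continuousWithinAt)
      (fun t _ => (hg t).differentiableAt.differentiableWithinAt) ?_
    intro t ht
    rw [interior_Icc] at ht
    rw [(hg t).deriv]
    linarith [hb t ht.1.le]
  have := hanti (Set.left_mem_Icc.2 zero_le_one) (Set.right_mem_Icc.2 zero_le_one) zero_le_one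
  simp only [g, one_smul, zero_smul, add_zero] at this
  linarith

lemma descent (hf : BlockSmooth f M ρ) (x h : Vec m n) : f
    (x + h) ≤ f x + ⟪∇ f x, h⟫ + M * ‖h‖ ^ 2 := by
  have := le_of_ray hf.diff x h (a := ⟪∇ f x, h⟫) (b := 2 * M * ‖h‖ ^ 2) (c := 0) ?_
  · linarith
  intro t ht
  have h1 := real_inner_le_norm (∇ f (x + t • h) - ∇ f x) h
  have h2 := hf.norm_grad_sub_le (x + t • h) x
  rw [add_sub_cancel_left, norm_smul, Real.norm_of_nonneg ht] at h2
  rw [inner_sub_left] at h1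
  nlinarith [norm_nonneg h]

lemma norm_grad_sub_hess_le (hf : BlockSmooth f M ρ) (z x y : Vec m n) {S : ℝ} (hx : ‖x - z‖ ≤ S)
    (hy : ‖y - z‖ ≤ S) :
    ‖∇ f y - ∇ f x - hess f z (y - x)‖ ≤ ρ * S * ‖y - x‖ := by
  refine (convex_closedBall z S).norm_image_sub_le_of_norm_fderiv_le' (𝕜 := ℝ)
    (fun w _ => hf.diff_grad w) ?_ (by simpa [dist_eq_norm] using hx)
    (by simpa [dist_eq_norm] using hy)
  intro w hw
  rw [Metric.mem_closedBall, dist_eq_norm] at hw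
  exact (hf.hessLip w z).trans (mul_le_mul_of_nonneg_left hw hf.rho_pos.le)

/-- Symmetry of second derivatives, carried from `fderiv` to the gradient by the Riesz map `J`. -/
lemma inner_hess_symm (hf : BlockSmooth f M ρ) (x u v : Vec m n) :
    ⟪u, hess f x v⟫ = ⟪hess f x u, v⟫ := by
  let J : Vec m n →L[ℝ] Vec m n →L[ℝ] ℝ :=
    LinearMap.mkContinuous₂ (innerₗ (Vec m n)) 1 fun x y => by
      simpa using norm_inner_le_norm (𝕜 := ℝ) x y
  have h1 : ∀ y, HasFDerivAt f (J (∇ f y)) y := by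
    intro y
    have : J (∇ f y) = fderiv ℝ f y := by
      ext w
      exact inner_gradient_left (𝕜 := ℝ) (f := f)
    rw [this]
    exact (hf.diff y).hasFDerivAt
  have h2 : HasFDerivAt (fun y => J (∇ f y)) (J.comp (hess f x)) x :=
    J.hasFDerivAt.comp x (hf.diff_grad x).hasFDerivAt
  have h3 := second_derivative_symmetric h1 h2 u v
  have h4 : ⟪hess f x u, v⟫ = ⟪hess f x v, u⟫ := h3
  rw [h4, real_inner_comm]

/-- Moving along a direction of negative curvature decreases `f`. -/
lemma exists_le_of_neg_curv (hf : BlockSmooth f M ρ) {γ : ℝ} (hγ : 0 < γ) (x e : Vec m n)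
    (he : ‖e‖ = 1)
    (hneg : ⟪e, hess f x e⟫ ≤ -γ) : ∃ y, f y ≤ f x - γ ^ 3 / (6 * ρ ^ 2) := by
  have hρ := hf.rho_pos
  wlog hs : ⟪∇ f x, e⟫ ≤ 0 generalizing e
  · refine this (-e) (by simpa using he) (by simpa using hneg) ?_
    rw [inner_neg_right]; linarith
  -- The length `γ/ρ` minimizes the upper bound `-γα²/2 + ρα³/3` for the change of `f`; the minimum
  -- is `-γ³/(6ρ²)`.
  refine ⟨x + (γ / ρ) • e, ?_⟩
  have hα : 0 < γ / ρ := div_pos hγ hρ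
  set α := γ / ρ with hαdef
  have := le_of_ray hf.diff x (α • e) (a := 0) (b := -γ * α ^ 2) (c := ρ * α ^ 3) ?_
  · have e2 : γ = ρ * α := by rw [hαdef]; field_simp
    rw [e2] at this ⊢
    have e3 : (ρ * α) ^ 3 / (6 * ρ ^ 2) = ρ * α ^ 3 / 6 := by field_simp
    rw [e3]
    nlinarith
  intro t ht
  have h1 := hf.norm_grad_sub_hess_le x x (x + t • α • e) (S := t * α) (by simp; positivity)
    (by simp [norm_smul, he, abs_of_nonneg ht, abs_of_pos hα])
  have h2 := real_inner_le_norm (∇ f (x + t • α • e) - ∇ f x - hess f x (t • α • e)) e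
  simp only [add_sub_cancel_left, norm_smul, he, Real.norm_of_nonneg ht,
    Real.norm_of_nonneg hα.le, mul_one] at h1 h2
  rw [inner_sub_left, inner_sub_left, map_smul, map_smul, inner_smul_left, inner_smul_left,
    ← hf.inner_hess_symm] at h2
  rw [map_smul, map_smul] at h1
  simp only [conj_trivial] at h2
  rw [inner_smul_right]
  have h3 : t * (α * ⟪e, hess f x e⟫) ≤ t * (α * -γ) := by gcongr
  have h4 : ⟪∇ f (x + t • α • e), e⟫ ≤ t * (α * -γ) + ρ * (t * α) * (t * α) := by linarith
  calc α * ⟪∇ f (x + t • α • e), e⟫ ≤ α * (t * (α * -γ) + ρ * (t * α) * (t * α)) := by gcongr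
    _ = _ := by ring

lemma exists_le_of_grad (hf : BlockSmooth f M ρ) (x : Vec m n) :
    ∃ y, f y ≤ f x - ‖∇ f x‖ ^ 2 / (4 * M) := by
  have hM := hf.pos
  refine ⟨x + (-(1 / (2 * M))) • ∇ f x, (hf.descent x _).trans (le_of_eq ?_)⟩
  rw [inner_smul_right, real_inner_self_eq_norm_sq, norm_smul, mul_pow, Real.norm_eq_abs, sq_abs]
  field_simp
  ring

end BlockSmooth

end Smooth

/-! ### The proximal sweep: existence, optimality conditions, descent, continuity. -/

section Prox

/-- A function bounded below plus a quadratic is coercive, so a minimizer exists and the choice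
operator picks one. -/
lemma argmin_prox_le {E : Type*} [NormedAddCommGroup E] [ProperSpace E] {F : E → ℝ}
    (hc : Continuous F) (hb : BddBelow (Set.range F)) {ν : ℝ} (hν : 0 < ν) (x w : E) :
    F (argmin fun z => F z + ν / 2 * ‖z - x‖ ^ 2)
      + ν / 2 * ‖(argmin fun z => F z + ν / 2 * ‖z - x‖ ^ 2) - x‖ ^ 2
      ≤ F w + ν / 2 * ‖w - x‖ ^ 2 := by
  obtain ⟨B, hB⟩ := hb
  have hB' : ∀ z, B ≤ F z := fun z => hB ⟨z, rfl⟩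
  have hlim : Filter.Tendsto (fun z => F z + ν / 2 * ‖z - x‖ ^ 2) (Filter.cocompact E)
      Filter.atTop := by
    have h1 : Filter.Tendsto (fun z : E => ‖z - x‖) (Filter.cocompact E) Filter.atTop := by
      simpa [dist_eq_norm] using tendsto_dist_right_cocompact_atTop x
    have h2 := ((Filter.tendsto_pow_atTop two_ne_zero).comp h1).const_mul_atTop (half_pos hν)
    exact Filter.tendsto_atTop_mono (fun z => add_le_add (hB' z) le_rfl)
      (Filter.tendsto_atTop_add_const_left _ B h2)
  have hex : ∃ z, ∀ w, (fun z => F z + ν / 2 * ‖z - x‖ ^ 2) z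
      ≤ (fun z => F z + ν / 2 * ‖z - x‖ ^ 2) w :=
    Continuous.exists_forall_le (by fun_prop) hlim
  exact Classical.epsilon_spec hex w

/-- Fermat's rule on every line through `z`; the direction `g + ν (z - x)` is then orthogonal to
itself. -/
lemma prox_stationary {E : Type*} [NormedAddCommGroup E] [InnerProductSpace ℝ E] {φ : E → ℝ}
    {ν : ℝ} {x z g : E} (hd : ∀ h, HasDerivAt (fun t : ℝ => φ (z + t • h)) ⟪g, h⟫ 0)
    (hmin : ∀ w, φ z + ν / 2 * ‖z - x‖ ^ 2 ≤ φ w + ν / 2 * ‖w - x‖ ^ 2) :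
    ν • (z - x) = -g := by
  have key : ∀ h, ⟪g, h⟫ + ν * ⟪z - x, h⟫ = 0 := by
    intro h
    have h1 : HasDerivAt (fun t : ℝ => z + t • h - x) h 0 := by
      simpa using (((hasDerivAt_id (0 : ℝ)).smul_const h).const_add z).sub_const x
    have h2 := (hd h).add (h1.norm_sq.const_mul (ν / 2))
    have h3 : IsLocalMin ((fun t : ℝ => φ (z + t • h)) +
        fun t : ℝ => ν / 2 * ‖z + t • h - x‖ ^ 2) 0 := by
      refine Filter.Eventually.of_forall fun t => ?_
      simpa using hmin (z + t • h)
    have h4 := h3.hasDerivAt_eq_zero h2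
    simp only [zero_smul, add_zero] at h4
    linarith
  have h5 := key (g + ν • (z - x))
  rw [← real_inner_smul_left, ← inner_add_left] at h5
  rw [eq_neg_iff_add_eq_zero, add_comm]
  exact inner_self_eq_zero.1 h5

variable {m n : ℕ} {f : Vec m n → ℝ} {M ρ ν : ℝ}

lemma continuous_join : Continuous fun p : EuclideanSpace ℝ (Fin m) × EuclideanSpace ℝ (Fin n) =>
    (join p.1 p.2 : Vec m n) := by
  refine (PiLp.continuous_toLp 2 _).comp (continuous_pi fun i => ?_)
  rcases i with i | i
  · exact (PiLp.continuous_apply 2 _ i).comp continuous_fst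
  · exact (PiLp.continuous_apply 2 _ i).comp continuous_snd

lemma join_add_smul_left (u h : EuclideanSpace ℝ (Fin m)) (v : EuclideanSpace ℝ (Fin n)) (t : ℝ) :
    (join (u + t • h) v : Vec m n) = join u v + t • join h 0 := by
  ext i; rcases i with i | i <;> simp [join]

lemma join_add_smul_right (u : EuclideanSpace ℝ (Fin m)) (v h : EuclideanSpace ℝ (Fin n)) (t : ℝ) :
    (join u (v + t • h) : Vec m n) = join u v + t • join 0 h := by
  ext i; rcases i with i | i <;> simp [join]

namespace BlockSmooth

lemma prox₁_le (hf : BlockSmooth f M ρ) (hb : BddBelow (Set.range f)) (hν : 0 < ν) (x : Vec m n)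
    (w : EuclideanSpace ℝ (Fin m)) :
    f (join (prox₁ f ν x) (blk₂ x)) + ν / 2 * ‖prox₁ f ν x - blk₁ x‖ ^ 2
      ≤ f (join w (blk₂ x)) + ν / 2 * ‖w - blk₁ x‖ ^ 2 :=
  argmin_prox_le (F := fun z => f (join z (blk₂ x)))
    (hf.diff.continuous.comp (continuous_join.comp (continuous_id.prodMk continuous_const)))
    (hb.mono (Set.range_comp_subset_range (fun z => join z (blk₂ x)) f)) hν (blk₁ x) w

lemma prox₂_le (hf : BlockSmooth f M ρ) (hb : BddBelow (Set.range f)) (hν : 0 < ν) (x : Vec m n)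
    (w : EuclideanSpace ℝ (Fin n)) :
    f (appStep f ν x) + ν / 2 * ‖prox₂ f ν x - blk₂ x‖ ^ 2
      ≤ f (join (prox₁ f ν x) w) + ν / 2 * ‖w - blk₂ x‖ ^ 2 :=
  argmin_prox_le (F := fun z => f (join (prox₁ f ν x) z))
    (hf.diff.continuous.comp (continuous_join.comp (continuous_const.prodMk continuous_id)))
    (hb.mono (Set.range_comp_subset_range (fun z => join (prox₁ f ν x) z) f)) hν (blk₂ x) w

lemma appStep_le (hf : BlockSmooth f M ρ) (hb : BddBelow (Set.range f)) (hν : 0 < ν)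
    (x : Vec m n) : f (appStep f ν x) + ν / 2 * ‖appStep f ν x - x‖ ^ 2 ≤ f x := by
  have h1 := hf.prox₁_le hb hν x (blk₁ x)
  have h2 := hf.prox₂_le hb hν x (blk₂ x)
  rw [norm_sq_eq_blk]
  simp only [blk₁_sub, blk₂_sub, join_blk, sub_self, norm_zero] at h1 h2 ⊢
  simp only [appStep, blk₁_join, blk₂_join] at h2 ⊢
  linarith

/-- Together with `prox₂_eq` this exhibits the sweep as a block-implicit gradient step in which the
second block sees the updated first one. -/
lemma prox₁_eq (hf : BlockSmooth f M ρ) (hb : BddBelow (Set.range f)) (hν : 0 < ν)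
    (x : Vec m n) :
    ν • (prox₁ f ν x - blk₁ x) = -grad₁ f (join (prox₁ f ν x) (blk₂ x)) := by
  refine prox_stationary (φ := fun z => f (join z (blk₂ x))) (fun h => ?_)
    (hf.prox₁_le hb hν x)
  have := hasDerivAt_ray hf.diff (join (prox₁ f ν x) (blk₂ x)) (join h 0) 0
  rw [inner_eq_blk] at this
  simpa [join_add_smul_left, grad₁] using this

lemma prox₂_eq (hf : BlockSmooth f M ρ) (hb : BddBelow (Set.range f)) (hν : 0 < ν)
    (x : Vec m n) :
    ν • (prox₂ f ν x - blk₂ x) = -grad₂ f (appStep f ν x) := by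
  refine prox_stationary (φ := fun z => f (join (prox₁ f ν x) z)) (fun h => ?_)
    (hf.prox₂_le hb hν x)
  have := hasDerivAt_ray hf.diff (join (prox₁ f ν x) (prox₂ f ν x)) (join 0 h) 0
  rw [inner_eq_blk] at this
  simpa [join_add_smul_right, grad₂, appStep] using this

/-- Subtracting the optimality conditions at `x` and `y` gives `p₁ ≤ 2q₁ + q₂` and `p₂ ≤ 2q₂ + p₁`
for the block distances `q` before and `p` after the sweep. This makes the sweep continuous, hence
measurable, although it is defined by a choice of minimizers. -/
lemma norm_appStep_sub_le (hf : BlockSmooth f M ρ) (hb : BddBelow (Set.range f))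
    (hν : 2 * M ≤ ν) (x y : Vec m n) : ‖appStep f ν x - appStep f ν y‖ ≤ 8 * ‖x - y‖ := by
  have hM := hf.pos
  have hν0 : 0 < ν := by linarith
  have a1 := hf.lip₁ (join (prox₁ f ν x) (blk₂ x)) (join (prox₁ f ν y) (blk₂ y))
  have a2 := hf.lip₂ (appStep f ν x) (appStep f ν y)
  have e1 : ν • ((prox₁ f ν x - prox₁ f ν y) - (blk₁ x - blk₁ y)) =
      -(grad₁ f (join (prox₁ f ν x) (blk₂ x)) - grad₁ f (join (prox₁ f ν y) (blk₂ y))) := by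
    rw [show ν • ((prox₁ f ν x - prox₁ f ν y) - (blk₁ x - blk₁ y)) =
      ν • (prox₁ f ν x - blk₁ x) - ν • (prox₁ f ν y - blk₁ y) by module,
      hf.prox₁_eq hb hν0 x, hf.prox₁_eq hb hν0 y]
    abel
  have e2 : ν • ((prox₂ f ν x - prox₂ f ν y) - (blk₂ x - blk₂ y)) =
      -(grad₂ f (appStep f ν x) - grad₂ f (appStep f ν y)) := by
    rw [show ν • ((prox₂ f ν x - prox₂ f ν y) - (blk₂ x - blk₂ y)) =
      ν • (prox₂ f ν x - blk₂ x) - ν • (prox₂ f ν y - blk₂ y) by module,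
      hf.prox₂_eq hb hν0 x, hf.prox₂_eq hb hν0 y]
    abel
  have n1 := congrArg norm e1
  have n2 := congrArg norm e2
  rw [norm_neg, norm_smul, Real.norm_of_nonneg hν0.le] at n1 n2
  have b1 := norm_sub_norm_le (prox₁ f ν x - prox₁ f ν y) (blk₁ x - blk₁ y)
  have b2 := norm_sub_norm_le (prox₂ f ν x - prox₂ f ν y) (blk₂ x - blk₂ y)
  have c1 := norm_blk₁_le (x - y)
  have c2 := norm_blk₂_le (x - y)
  have c3 := norm_le_blk (appStep f ν x - appStep f ν y)
  simp only [blk₁_join, blk₂_join, blk₁_sub, blk₂_sub] at a1 a2 c1 c2 c3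
  simp only [appStep, blk₁_join, blk₂_join] at a2 c3 n2 ⊢
  set p1 := ‖prox₁ f ν x - prox₁ f ν y‖
  set p2 := ‖prox₂ f ν x - prox₂ f ν y‖
  set q1 := ‖blk₁ x - blk₁ y‖
  set q2 := ‖blk₂ x - blk₂ y‖
  have hp1 : 0 ≤ p1 := norm_nonneg _
  have hp2 : 0 ≤ p2 := norm_nonneg _
  have hq2 : 0 ≤ q2 := norm_nonneg _
  have d1 : p1 - q1 ≤ (p1 + q2) / 2 := by
    refine le_of_mul_le_mul_left ?_ hν0
    calc ν * (p1 - q1) ≤ M * (p1 + q2) := by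
          refine (mul_le_mul_of_nonneg_left b1 hν0.le).trans ?_
          rw [n1]; exact a1
      _ ≤ ν * ((p1 + q2) / 2) := by nlinarith
  have d2 : p2 - q2 ≤ (p1 + p2) / 2 := by
    refine le_of_mul_le_mul_left ?_ hν0
    calc ν * (p2 - q2) ≤ M * (p1 + p2) := by
          refine (mul_le_mul_of_nonneg_left b2 hν0.le).trans ?_
          rw [n2]; exact a2
      _ ≤ ν * ((p1 + p2) / 2) := by nlinarith
  linarith

lemma continuous_appStep (hf : BlockSmooth f M ρ) (hb : BddBelow (Set.range f))
    (hν : 2 * M ≤ ν) : Continuous (appStep f ν) := by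
  refine (LipschitzWith.of_dist_le_mul (K := 8) fun x y => ?_).continuous
  simpa [dist_eq_norm] using hf.norm_appStep_sub_le hb hν x y

/-- Optimality gives the partial gradients at `(x₁⁺, x₂)` and at `(x₁⁺, x₂⁺)`; carrying them back to
`x` costs `M ≤ ν/2` times the displacements. -/
lemma norm_grad_le (hf : BlockSmooth f M ρ) (hb : BddBelow (Set.range f))
    (hν : 2 * M ≤ ν) (x : Vec m n) : ‖∇ f x‖ ≤ 4 * ν * ‖appStep f ν x - x‖ := by
  have hM := hf.pos
  have hν0 : 0 < ν := by linarith
  have n1 := congrArg norm (hf.prox₁_eq hb hν0 x)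
  have n2 := congrArg norm (hf.prox₂_eq hb hν0 x)
  rw [norm_neg, norm_smul, Real.norm_of_nonneg hν0.le] at n1 n2
  have a1 := hf.lip₁ x (join (prox₁ f ν x) (blk₂ x))
  have a2 := hf.lip₂ x (appStep f ν x)
  have b1 := norm_le_norm_add_norm_sub' (grad₁ f x) (grad₁ f (join (prox₁ f ν x) (blk₂ x)))
  have b2 := norm_le_norm_add_norm_sub' (grad₂ f x) (grad₂ f (appStep f ν x))
  have c1 := norm_blk₁_le (appStep f ν x - x)
  have c2 := norm_blk₂_le (appStep f ν x - x)
  have c3 : ‖∇ f x‖ ≤ ‖grad₁ f x‖ + ‖grad₂ f x‖ := norm_le_blk _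
  rw [← n1] at b1
  rw [← n2] at b2
  have e1 : blk₁ (appStep f ν x) = prox₁ f ν x := rfl
  have e2 : blk₂ (appStep f ν x) = prox₂ f ν x := rfl
  simp only [blk₁_join, blk₂_join, blk₁_sub, blk₂_sub, e1, e2, sub_self, norm_zero, add_zero]
    at a1 a2 c1 c2
  rw [norm_sub_rev (blk₁ x)] at a1 a2
  rw [norm_sub_rev (blk₂ x)] at a2
  nlinarith [norm_nonneg (appStep f ν x - x)]

end BlockSmooth

end Prox

/-! ### Energy of the rescaled linear iteration. -/

section Energy

/-- A quantity `q` that grows by the squared increments of `n`, up to an error controlled by `n`,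
keeps at least half of its initial value. -/
lemma half_le_of_increments {q n p : ℕ → ℝ} {ν θ R g : ℝ} {T : ℕ} (hν : 0 < ν) (hθ : 0 ≤ θ)
    (hg : 0 < g) (hn0 : ∀ k, 0 ≤ n k) (hn : ∀ k < T, n (k + 1) ≤ n k + p k)
    (hq : ∀ k < T, q k + ν / 2 * p k ^ 2 ≤ q (k + 1) + θ / ν * (n k ^ 2 + n (k + 1) ^ 2))
    (h0 : g * n 0 ^ 2 ≤ q 0) (hR1 : 2 / g ≤ R) (hR2 : 4 * T / ν ≤ R)
    (hsmall : 4 * (T / ν) * θ * R ≤ 1) : q 0 / 2 ≤ q T := by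
  have hq0 : 0 ≤ q 0 := le_trans (by positivity) h0
  have hR : 0 ≤ R := le_trans (by positivity) hR1
  let P : ℕ → ℝ := fun t => ∑ k ∈ Finset.range t, p k ^ 2
  let E : ℕ → ℝ := fun t => ∑ k ∈ Finset.range t, θ / ν * (n k ^ 2 + n (k + 1) ^ 2)
  have hP0 : ∀ t, 0 ≤ P t := fun t => Finset.sum_nonneg fun k _ => sq_nonneg _
  have hPmono : Monotone P := fun a b hab =>
    Finset.sum_le_sum_of_subset_of_nonneg (Finset.range_mono hab) fun k _ _ => sq_nonneg _
  have claim1 : ∀ t ≤ T, q 0 + ν / 2 * P t ≤ q t + E t := by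
    intro t
    induction t with
    | zero => intro _; simp [P, E]
    | succ t ih =>
      intro ht
      have h1 := ih (by omega)
      have h2 := hq t (by omega)
      simp only [P, E, Finset.sum_range_succ] at h1 ⊢
      linarith
  have claim2 : ∀ t ≤ T, n t ≤ n 0 + ∑ k ∈ Finset.range t, p k := by
    intro t
    induction t with
    | zero => intro _; simp
    | succ t ih =>
      intro ht
      rw [Finset.sum_range_succ]
      linarith [ih (by omega), hn t (by omega)]
  -- Cauchy–Schwarz gives `n t² ≤ 2 n 0² + 2 T P T`, and both terms are controlled by the very
  -- quantity from which the errors are to be subtracted.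
  have claim3 : ∀ t ≤ T, n t ^ 2 ≤ R * (q 0 + ν / 2 * P T) := by
    intro t ht
    have h1 := pow_le_pow_left₀ (hn0 t) (claim2 t ht) 2
    have h2 : (∑ k ∈ Finset.range t, p k) ^ 2 ≤ t * P t := by
      simpa using sq_sum_le_card_mul_sum_sq (s := Finset.range t) (f := p)
    have h3 : (t : ℝ) * P t ≤ T * P T := by
      have : (t : ℝ) ≤ T := by exact_mod_cast ht
      exact mul_le_mul this (hPmono ht) (hP0 t) (by positivity)
    have h4 : 2 * n 0 ^ 2 ≤ R * q 0 := by
      calc 2 * n 0 ^ 2 = 2 / g * (g * n 0 ^ 2) := by field_simp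
        _ ≤ R * q 0 := mul_le_mul hR1 h0 (by positivity) hR
    have h5 : 2 * (T * P T) ≤ R * (ν / 2 * P T) := by
      calc 2 * (T * P T) = 4 * T / ν * (ν / 2 * P T) := by field_simp; ring
        _ ≤ _ := mul_le_mul_of_nonneg_right hR2 (by have := hP0 T; positivity)
    nlinarith [sq_nonneg (n 0 - ∑ k ∈ Finset.range t, p k)]
  have hB0 : 0 ≤ q 0 + ν / 2 * P T := by have := hP0 T; positivity
  have hE : E T ≤ (q 0 + ν / 2 * P T) / 2 := by
    have h1 : E T ≤ ∑ _k ∈ Finset.range T, θ / ν * (2 * (R * (q 0 + ν / 2 * P T))) := by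
      refine Finset.sum_le_sum fun k hk => ?_
      have hk := Finset.mem_range.1 hk
      have := claim3 k hk.le
      have := claim3 (k + 1) hk
      gcongr
      linarith
    rw [Finset.sum_const, Finset.card_range, nsmul_eq_mul] at h1
    calc E T ≤ _ := h1
      _ = (4 * (T / ν) * θ * R) * ((q 0 + ν / 2 * P T) / 2) := by field_simp; ring
      _ ≤ 1 * ((q 0 + ν / 2 * P T) / 2) := by gcongr
      _ = _ := one_mul _
  have h1 := claim1 T le_rfl
  have h2 : 0 ≤ ν / 2 * P T := by have := hP0 T; positivity
  linarith

/-- One inexact proximal step for a quadratic function decreases it. -/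
lemma quadratic_prox_step {E : Type*} [NormedAddCommGroup E] [InnerProductSpace ℝ E]
    (A : E →ₗ[ℝ] E) (hA : ∀ u v, ⟪u, A v⟫ = ⟪A u, v⟫) {ν : ℝ} (hν : 0 < ν)
    (hlow : ∀ u, -(ν / 2) * ‖u‖ ^ 2 ≤ ⟪u, A u⟫) {v v' b ε : E}
    (h : ν • (v' - v) = -(A v' + b + ε)) :
    ⟪v', A v'⟫ / 2 + ⟪v', b⟫ + ν / 2 * ‖v' - v‖ ^ 2 ≤
      ⟪v, A v⟫ / 2 + ⟪v, b⟫ + ‖ε‖ ^ 2 / ν := by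
  obtain ⟨p, rfl⟩ : ∃ p, v = v' - p := ⟨v' - v, by abel⟩
  rw [sub_sub_cancel] at h ⊢
  have h1 : ν * ‖p‖ ^ 2 = -(⟪p, A v'⟫ + ⟪p, b⟫ + ⟪p, ε⟫) := by
    rw [← real_inner_self_eq_norm_sq, ← real_inner_smul_right, h, inner_neg_right,
      inner_add_right, inner_add_right]
  have h2 : ⟪v' - p, A (v' - p)⟫ = ⟪v', A v'⟫ - 2 * ⟪p, A v'⟫ + ⟪p, A p⟫ := by
    rw [map_sub, inner_sub_left, inner_sub_right, inner_sub_right, hA v' p,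
      real_inner_comm p (A v')]
    ring
  have h3 := hlow p
  have h4 := abs_le.1 (abs_real_inner_le_norm p ε)
  -- Of the `ν ‖p‖²` supplied by the step equation, one quarter pays for the concavity allowed by
  -- `hlow`, one quarter for the error, and half remains.
  have h5 : ‖p‖ * ‖ε‖ ≤ ν / 4 * ‖p‖ ^ 2 + ‖ε‖ ^ 2 / ν := by
    have : ν / 4 * ‖p‖ ^ 2 + ‖ε‖ ^ 2 / ν - ‖p‖ * ‖ε‖ = (ν / 2 * ‖p‖ - ‖ε‖) ^ 2 / ν := by
      field_simp; ring
    have : 0 ≤ (ν / 2 * ‖p‖ - ‖ε‖) ^ 2 / ν := by positivity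
    linarith
  rw [h2, inner_sub_left]
  linarith [h4.1]

variable {m n : ℕ}

/-- The quadratic form of the operator with diagonal blocks `s² Hᵢᵢ + a` and off-diagonal blocks
`s Hᵢⱼ`, halved. Along the alternating proximal point method for the quadratic function with
Hessian `H`, rescaled by the growth factor `s² = 1 + a / ν`, it is nonincreasing. -/
noncomputable def scaledEnergy (H : Vec m n →L[ℝ] Vec m n) (s a : ℝ) (v : Vec m n) : ℝ :=
  (s ^ 2 * ⟪join (blk₁ v) 0, H (join (blk₁ v) 0)⟫ + a * ‖blk₁ v‖ ^ 2) / 2 +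
  (s ^ 2 * ⟪join 0 (blk₂ v), H (join 0 (blk₂ v))⟫ + a * ‖blk₂ v‖ ^ 2) / 2 +
  s * ⟪join (blk₁ v) 0, H (join 0 (blk₂ v))⟫

/-- Embedding of the first block. -/
noncomputable def inl₁ : EuclideanSpace ℝ (Fin m) →ₗ[ℝ] Vec m n where
  toFun u := join u 0
  map_add' u v := by ext i; rcases i with i | i <;> simp [join]
  map_smul' c u := by ext i; rcases i with i | i <;> simp [join]

/-- Embedding of the second block. -/
noncomputable def inr₂ : EuclideanSpace ℝ (Fin n) →ₗ[ℝ] Vec m n where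
  toFun u := join 0 u
  map_add' u v := by ext i; rcases i with i | i <;> simp [join]
  map_smul' c u := by ext i; rcases i with i | i <;> simp [join]

/-- The first block as a linear map. -/
noncomputable def fst₁ : Vec m n →ₗ[ℝ] EuclideanSpace ℝ (Fin m) where
  toFun := blk₁
  map_add' _ _ := rfl
  map_smul' _ _ := rfl

/-- The second block as a linear map. -/
noncomputable def snd₂ : Vec m n →ₗ[ℝ] EuclideanSpace ℝ (Fin n) where
  toFun := blk₂
  map_add' _ _ := rfl
  map_smul' _ _ := rfl

lemma inner_join_left_zero (u : EuclideanSpace ℝ (Fin m)) (x : Vec m n) :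
    ⟪(join u 0 : Vec m n), x⟫ = ⟪u, blk₁ x⟫ := by simp [inner_eq_blk]

lemma inner_join_zero_right (u : EuclideanSpace ℝ (Fin n)) (x : Vec m n) :
    ⟪(join 0 u : Vec m n), x⟫ = ⟪u, blk₂ x⟫ := by simp [inner_eq_blk]

lemma join_eq_add (u : EuclideanSpace ℝ (Fin m)) (v : EuclideanSpace ℝ (Fin n)) :
    (join u v : Vec m n) = join u 0 + join 0 v := by
  ext i; rcases i with i | i <;> simp [join]

lemma norm_join_left (u : EuclideanSpace ℝ (Fin m)) : ‖(join u 0 : Vec m n)‖ = ‖u‖ := by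
  rw [← sq_eq_sq₀ (norm_nonneg _) (norm_nonneg _), norm_sq_eq_blk]; simp

lemma norm_join_right (u : EuclideanSpace ℝ (Fin n)) : ‖(join 0 u : Vec m n)‖ = ‖u‖ := by
  rw [← sq_eq_sq₀ (norm_nonneg _) (norm_nonneg _), norm_sq_eq_blk]; simp

variable {H : Vec m n →L[ℝ] Vec m n} {M ν s a : ℝ}

/-- Each update is a proximal step for its diagonal block, with the other block as linear term. As
`H` is symmetric and the off-diagonal coefficient is `s` in both equations, the intermediate cross
terms cancel in the sum. -/
lemma scaledEnergy_step (hH : ∀ u v, ⟪u, H v⟫ = ⟪H u, v⟫)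
    (hb : ∀ u v, |⟪u, H v⟫| ≤ 2 * M * ‖u‖ * ‖v‖) (hM : 0 < M) (hν : 8 * M ≤ ν)
    (hs : s ^ 2 ≤ 2) (ha : 0 ≤ a) {v v' : Vec m n}
    {ε₁ : EuclideanSpace ℝ (Fin m)} {ε₂ : EuclideanSpace ℝ (Fin n)}
    (h₁ : ν • (blk₁ v' - blk₁ v) = -(s ^ 2 • blk₁ (H (join (blk₁ v') 0)) + a • blk₁ v'
      + s • blk₁ (H (join 0 (blk₂ v))) + ε₁))
    (h₂ : ν • (blk₂ v' - blk₂ v) = -(s ^ 2 • blk₂ (H (join 0 (blk₂ v'))) + a • blk₂ v'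
      + s • blk₂ (H (join (blk₁ v') 0)) + ε₂)) :
    scaledEnergy H s a v' + ν / 2 * ‖v' - v‖ ^ 2 ≤
      scaledEnergy H s a v + (‖ε₁‖ ^ 2 + ‖ε₂‖ ^ 2) / ν := by
  have hν0 : 0 < ν := by linarith
  let A₁ : EuclideanSpace ℝ (Fin m) →ₗ[ℝ] EuclideanSpace ℝ (Fin m) :=
    s ^ 2 • (fst₁ ∘ₗ (H : Vec m n →ₗ[ℝ] Vec m n) ∘ₗ inl₁) + a • LinearMap.id
  let A₂ : EuclideanSpace ℝ (Fin n) →ₗ[ℝ] EuclideanSpace ℝ (Fin n) :=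
    s ^ 2 • (snd₂ ∘ₗ (H : Vec m n →ₗ[ℝ] Vec m n) ∘ₗ inr₂) + a • LinearMap.id
  have eA₁ : ∀ u w, ⟪u, A₁ w⟫ = s ^ 2 * ⟪(join u 0 : Vec m n), H (join w 0)⟫ + a * ⟪u, w⟫ := by
    intro u w
    rw [inner_join_left_zero]
    simp [A₁, fst₁, inl₁, inner_add_right, inner_smul_right]
    exact Or.inl rfl
  have eA₂ : ∀ u w, ⟪u, A₂ w⟫ = s ^ 2 * ⟪(join 0 u : Vec m n), H (join 0 w)⟫ + a * ⟪u, w⟫ := by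
    intro u w
    rw [inner_join_zero_right]
    simp [A₂, snd₂, inr₂, inner_add_right, inner_smul_right]
    exact Or.inl rfl
  have k1 := quadratic_prox_step A₁
    (fun u w => by
      rw [real_inner_comm w (A₁ u), eA₁, eA₁, hH, real_inner_comm (H (join u 0)),
        real_inner_comm w u]) hν0
    (fun u => by
      rw [eA₁, real_inner_self_eq_norm_sq]
      have h3 := (abs_le.1 (hb (join u 0) (join u 0))).1
      rw [norm_join_left] at h3
      nlinarith [mul_le_mul_of_nonneg_left h3 (sq_nonneg s),
        mul_le_mul_of_nonneg_right hs (mul_nonneg hM.le (sq_nonneg ‖u‖)),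
        mul_nonneg ha (sq_nonneg ‖u‖), mul_le_mul_of_nonneg_right hν (sq_nonneg ‖u‖)])
    (v := blk₁ v) (v' := blk₁ v') (b := s • blk₁ (H (join 0 (blk₂ v)))) (ε := ε₁)
    (by rw [h₁]; rfl)
  have k2 := quadratic_prox_step A₂
    (fun u w => by
      rw [real_inner_comm w (A₂ u), eA₂, eA₂, hH, real_inner_comm (H (join 0 u)),
        real_inner_comm w u]) hν0
    (fun u => by
      rw [eA₂, real_inner_self_eq_norm_sq]
      have h3 := (abs_le.1 (hb (join 0 u) (join 0 u))).1
      rw [norm_join_right] at h3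
      nlinarith [mul_le_mul_of_nonneg_left h3 (sq_nonneg s),
        mul_le_mul_of_nonneg_right hs (mul_nonneg hM.le (sq_nonneg ‖u‖)),
        mul_nonneg ha (sq_nonneg ‖u‖), mul_le_mul_of_nonneg_right hν (sq_nonneg ‖u‖)])
    (v := blk₂ v) (v' := blk₂ v') (b := s • blk₂ (H (join (blk₁ v') 0))) (ε := ε₂)
    (by rw [h₂]; rfl)
  have c : ∀ x : Vec m n, ∀ y : Vec m n, ⟪blk₂ x, blk₂ (H (join (blk₁ y) 0))⟫ =
      ⟪(join (blk₁ y) 0 : Vec m n), H (join 0 (blk₂ x))⟫ := by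
    intro x y
    rw [← inner_join_zero_right, hH, real_inner_comm]
  have c₁ : ∀ x : Vec m n, ∀ y : Vec m n, ⟪blk₁ x, blk₁ (H (join 0 (blk₂ y)))⟫ =
      ⟪(join (blk₁ x) 0 : Vec m n), H (join 0 (blk₂ y))⟫ := by
    intro x y
    rw [← inner_join_left_zero]
  rw [eA₁, eA₁, real_inner_smul_right, real_inner_smul_right, c₁, c₁, real_inner_self_eq_norm_sq, real_inner_self_eq_norm_sq] at k1
  rw [eA₂, eA₂, real_inner_smul_right, real_inner_smul_right, c, c,
    real_inner_self_eq_norm_sq, real_inner_self_eq_norm_sq] at k2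
  rw [norm_sq_eq_blk (v' - v), blk₁_sub, blk₂_sub, scaledEnergy, scaledEnergy, add_div (‖ε₁‖ ^ 2)]
  linarith

lemma neg_scaledEnergy_le (hb : ∀ u v, |⟪u, H v⟫| ≤ 2 * M * ‖u‖ * ‖v‖) (hM : 0 < M)
    (hs0 : 0 ≤ s) (hs : s ^ 2 ≤ 2) (ha : 0 ≤ a) (v : Vec m n) :
    -scaledEnergy H s a v ≤ 5 * M * ‖v‖ ^ 2 := by
  have h1 := (abs_le.1 (hb (join (blk₁ v) 0) (join (blk₁ v) 0))).1
  have h2 := (abs_le.1 (hb (join 0 (blk₂ v)) (join 0 (blk₂ v)))).1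
  have h3 := (abs_le.1 (hb (join (blk₁ v) 0) (join 0 (blk₂ v)))).1
  rw [norm_join_left] at h1 h3
  rw [norm_join_right] at h2 h3
  have hs' : s ≤ 2 := by nlinarith
  rw [scaledEnergy, norm_sq_eq_blk v]
  have e1 : -(4 * M * ‖blk₁ v‖ ^ 2) ≤
      s ^ 2 * ⟪(join (blk₁ v) 0 : Vec m n), H (join (blk₁ v) 0)⟫ := by
    nlinarith [mul_le_mul_of_nonneg_left h1 (sq_nonneg s),
        mul_le_mul_of_nonneg_right hs (mul_nonneg hM.le (sq_nonneg ‖blk₁ v‖))]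
  have e2 : -(4 * M * ‖blk₂ v‖ ^ 2) ≤
      s ^ 2 * ⟪(join 0 (blk₂ v) : Vec m n), H (join 0 (blk₂ v))⟫ := by
    nlinarith [mul_le_mul_of_nonneg_left h2 (sq_nonneg s),
        mul_le_mul_of_nonneg_right hs (mul_nonneg hM.le (sq_nonneg ‖blk₂ v‖))]
  have e3 : -(4 * M * (‖blk₁ v‖ * ‖blk₂ v‖)) ≤
      s * ⟪(join (blk₁ v) 0 : Vec m n), H (join 0 (blk₂ v))⟫ := by
    have := mul_nonneg hM.le (mul_nonneg (norm_nonneg (blk₁ v)) (norm_nonneg (blk₂ v)))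
    nlinarith [mul_le_mul_of_nonneg_left h3 hs0, mul_le_mul_of_nonneg_right hs' this]
  have e4 : 0 ≤ a * ‖blk₁ v‖ ^ 2 := by positivity
  have e5 : 0 ≤ a * ‖blk₂ v‖ ^ 2 := by positivity
  nlinarith [mul_nonneg hM.le (sq_nonneg (‖blk₁ v‖ - ‖blk₂ v‖)),
    mul_nonneg hM.le (sq_nonneg ‖blk₁ v‖), mul_nonneg hM.le (sq_nonneg ‖blk₂ v‖)]

/-- Twice the energy is `⟪w, H w⟫` plus at most `a/4 + a` times `‖w‖²`: the first from `(s² - 1)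
⟪w₁, H w₁⟫`, the second from the shift. With `a ≤ γ/2` at most `-3γ/8` is left. -/
lemma scaledEnergy_le_of_neg_curv (hH : ∀ u v, ⟪u, H v⟫ = ⟪H u, v⟫)
    (hb : ∀ u v, |⟪u, H v⟫| ≤ 2 * M * ‖u‖ * ‖v‖) {γ : ℝ}
    (hs : 1 ≤ s) (hsa : (s ^ 2 - 1) * (8 * M) ≤ a) (ha : 0 ≤ a) (haγ : a ≤ γ / 2) {w : Vec m n}
    (hw : ⟪w, H w⟫ ≤ -γ * ‖w‖ ^ 2) :
    scaledEnergy H s a (join (blk₁ w) (s⁻¹ • blk₂ w)) ≤ -(γ / 8 * ‖w‖ ^ 2) := by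
  have hs0 : 0 < s := by linarith
  have hs1 : 0 ≤ s ^ 2 - 1 := by nlinarith
  have e : (join 0 (s⁻¹ • blk₂ w) : Vec m n) = s⁻¹ • join 0 (blk₂ w) := inr₂.map_smul _ _
  have h1 := (abs_le.1 (hb (join (blk₁ w) 0) (join (blk₁ w) 0))).2
  rw [norm_join_left] at h1
  have hw' : ⟪w, H w⟫ = ⟪(join (blk₁ w) 0 : Vec m n), H (join (blk₁ w) 0)⟫ +
      ⟪(join 0 (blk₂ w) : Vec m n), H (join 0 (blk₂ w))⟫ +
      2 * ⟪(join (blk₁ w) 0 : Vec m n), H (join 0 (blk₂ w))⟫ := by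
    have : w = join (blk₁ w) 0 + join 0 (blk₂ w) := by rw [← join_eq_add, join_blk]
    conv_lhs => rw [this]
    rw [map_add, inner_add_left, inner_add_right, inner_add_right,
      hH (join 0 (blk₂ w)) (join (blk₁ w) 0), real_inner_comm (join (blk₁ w) 0)]
    ring
  simp only [scaledEnergy, blk₁_join, blk₂_join, e, map_smul, real_inner_smul_left,
    real_inner_smul_right, norm_smul, Real.norm_eq_abs, mul_pow, sq_abs, inv_pow]
  have e2 : s ^ 2 * (s⁻¹ * (s⁻¹ * ⟪(join 0 (blk₂ w) : Vec m n), H (join 0 (blk₂ w))⟫)) =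
    ⟪(join 0 (blk₂ w) : Vec m n), H (join 0 (blk₂ w))⟫ := by field_simp
  have e3 : s * (s⁻¹ * ⟪(join (blk₁ w) 0 : Vec m n), H (join 0 (blk₂ w))⟫) =
    ⟪(join (blk₁ w) 0 : Vec m n), H (join 0 (blk₂ w))⟫ := by field_simp
  have e4 : a * ((s ^ 2)⁻¹ * ‖blk₂ w‖ ^ 2) ≤ a * ‖blk₂ w‖ ^ 2 := by
    have : (s ^ 2)⁻¹ ≤ 1 := inv_le_one_of_one_le₀ (by linarith)
    have := mul_le_mul_of_nonneg_right this (sq_nonneg ‖blk₂ w‖)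
    nlinarith
  rw [e2, e3]
  have e5 := norm_sq_eq_blk w
  have e6 : (s ^ 2 - 1) * ⟪(join (blk₁ w) 0 : Vec m n), H (join (blk₁ w) 0)⟫ ≤
      a / 4 * ‖blk₁ w‖ ^ 2 := by
    nlinarith [mul_le_mul_of_nonneg_left h1 hs1, mul_le_mul_of_nonneg_right hsa
      (sq_nonneg ‖blk₁ w‖)]
  have e7 : a / 4 * ‖blk₁ w‖ ^ 2 ≤ a / 4 * ‖w‖ ^ 2 := by
    have := sq_nonneg ‖blk₂ w‖
    exact mul_le_mul_of_nonneg_left (by linarith) (by positivity)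
  have e8 : a * ‖w‖ ^ 2 ≤ γ / 2 * ‖w‖ ^ 2 := by gcongr
  have : 0 ≤ a * ‖w‖ ^ 2 := by positivity
  nlinarith

end Energy

/-! ### Exponential separation of trajectories, and localization. -/

section Escape

variable {m n : ℕ} {f : Vec m n → ℝ} {M ρ ν : ℝ}

/-- The optimality conditions of both trajectories are linearized at the fixed point `z`. The first
is evaluated at the mixed point `(x₁⁺, x₂)`, which is only known to lie within `2S` of `z`. -/
lemma BlockSmooth.appStep_sub_step (hf : BlockSmooth f M ρ) (hb : BddBelow (Set.range f))
    (hν : 0 < ν) {x y z : Vec m n} {S : ℝ} (hx : ‖x - z‖ ≤ S) (hy : ‖y - z‖ ≤ S)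
    (hx' : ‖appStep f ν x - z‖ ≤ S) (hy' : ‖appStep f ν y - z‖ ≤ S)
    {w w' : Vec m n} (hw : w = y - x) (hw' : w' = appStep f ν y - appStep f ν x) :
    ∃ e₁ e₂, ν • (blk₁ w' - blk₁ w) = -(blk₁ (hess f z (join (blk₁ w') (blk₂ w))) + e₁) ∧
      ‖e₁‖ ≤ 2 * ρ * S * (‖blk₁ w'‖ + ‖blk₂ w‖) ∧
      ν • (blk₂ w' - blk₂ w) = -(blk₂ (hess f z w') + e₂) ∧ ‖e₂‖ ≤ 2 * ρ * S * ‖w'‖ := by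
  have hρ := hf.rho_pos
  have hS : 0 ≤ S := (norm_nonneg _).trans hx
  have key : ∀ u : Vec m n, ‖u - z‖ ≤ S → ‖appStep f ν u - z‖ ≤ S →
      ‖join (prox₁ f ν u) (blk₂ u) - z‖ ≤ 2 * S := by
    intro u h1 h2
    have h3 := norm_le_blk (join (prox₁ f ν u) (blk₂ u) - z)
    have h4 := norm_blk₁_le (appStep f ν u - z)
    have h5 := norm_blk₂_le (u - z)
    simp only [appStep, blk₁_sub, blk₂_sub, blk₁_join, blk₂_join] at h2 h3 h4 h5
    linarith
  have hj : join (prox₁ f ν y) (blk₂ y) - join (prox₁ f ν x) (blk₂ x) =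
      join (blk₁ w') (blk₂ w) := by
    rw [hw, hw']
    ext i; rcases i with i | i <;> rfl
  have g1 := hf.norm_grad_sub_hess_le z _ _ (key x hx hx') (key y hy hy')
  have g2 := hf.norm_grad_sub_hess_le z _ _ hx' hy'
  rw [hj] at g1
  rw [← hw'] at g2
  refine ⟨_, _, ?_, (norm_blk₁_le _).trans (g1.trans ?_), ?_, (norm_blk₂_le _).trans (g2.trans ?_)⟩
  · rw [blk₁_sub, blk₁_sub, add_sub_cancel, hw, hw', blk₁_sub, blk₁_sub]
    have e1 := hf.prox₁_eq hb hν x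
    have e2 := hf.prox₁_eq hb hν y
    simp only [grad₁] at e1 e2
    rw [show ν • (blk₁ (appStep f ν y) - blk₁ (appStep f ν x) - (blk₁ y - blk₁ x)) =
      ν • (prox₁ f ν y - blk₁ y) - ν • (prox₁ f ν x - blk₁ x) by
        simp only [appStep, blk₁_join]; module, e1, e2]
    abel
  · have h6 := norm_le_blk (join (blk₁ w') (blk₂ w))
    rw [blk₁_join, blk₂_join] at h6
    calc ρ * (2 * S) * ‖join (blk₁ w') (blk₂ w)‖ ≤ ρ * (2 * S) * (‖blk₁ w'‖ + ‖blk₂ w‖) := by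
          gcongr
      _ = _ := by ring
  · rw [blk₂_sub, blk₂_sub, add_sub_cancel, hw, hw', blk₂_sub, blk₂_sub]
    have e1 := hf.prox₂_eq hb hν x
    have e2 := hf.prox₂_eq hb hν y
    simp only [grad₂] at e1 e2
    rw [show ν • (blk₂ (appStep f ν y) - blk₂ (appStep f ν x) - (blk₂ y - blk₂ x)) =
      ν • (prox₂ f ν y - blk₂ y) - ν • (prox₂ f ν x - blk₂ x) by
        simp only [appStep, blk₂_join]; module, e1, e2]
    abel
  · have : 0 ≤ ρ * S * ‖w'‖ := by positivity
    linarith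

/-- The second block is scaled by an extra factor `s`, half a time step ahead. Dividing the
equations by `k` and `k s` then leaves the same off-diagonal coefficient `s` in both, so symmetry
survives, and the growth of the scale becomes the shift `a = ν (s² - 1)`. -/
lemma rescaled_step {H : Vec m n →L[ℝ] Vec m n} {s a k θ : ℝ}
    (hH : ∀ u v, ⟪u, H v⟫ = ⟪H u, v⟫)
    (hb : ∀ u v, |⟪u, H v⟫| ≤ 2 * M * ‖u‖ * ‖v‖) (hM : 0 < M) (hν : 8 * M ≤ ν)
    (hs0 : 0 < s) (hs : s ^ 2 ≤ 2) (ha : 0 ≤ a) (hsa : ν * (s ^ 2 - 1) = a) (hk : 0 < k)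
    (hθ : 0 ≤ θ) {w w' v v' : Vec m n}
    {e₁ : EuclideanSpace ℝ (Fin m)} {e₂ : EuclideanSpace ℝ (Fin n)}
    (h₁ : ν • (blk₁ w' - blk₁ w) = -(blk₁ (H (join (blk₁ w') (blk₂ w))) + e₁))
    (he₁ : ‖e₁‖ ≤ θ * (‖blk₁ w'‖ + ‖blk₂ w‖))
    (h₂ : ν • (blk₂ w' - blk₂ w) = -(blk₂ (H w') + e₂)) (he₂ : ‖e₂‖ ≤ θ * ‖w'‖)
    (hw₁ : blk₁ w = k • blk₁ v) (hw₂ : blk₂ w = (k * s) • blk₂ v)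
    (hw₁' : blk₁ w' = (k * s ^ 2) • blk₁ v') (hw₂' : blk₂ w' = (k * s ^ 3) • blk₂ v') :
    scaledEnergy H s a v' + ν / 2 * ‖v' - v‖ ^ 2 ≤
      scaledEnergy H s a v + 32 * θ ^ 2 / ν * (‖v‖ ^ 2 + ‖v'‖ ^ 2) := by
  have hs2 : s ≤ 2 := by nlinarith
  have hν0 : 0 < ν := by linarith
  have hj : ∀ (b c : ℝ) (u : EuclideanSpace ℝ (Fin m)) (v : EuclideanSpace ℝ (Fin n)),
      H (join (b • u) (c • v)) = b • H (join u 0) + c • H (join 0 v) := by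
    intro b c u v
    rw [join_eq_add, map_add, ← map_smul, ← map_smul]
    exact congrArg₂ (· + ·) (congrArg H (inl₁.map_smul b u)) (congrArg H (inr₂.map_smul c v))
  have n1 : ‖blk₁ w'‖ = k * s ^ 2 * ‖blk₁ v'‖ := by
    rw [hw₁', norm_smul, Real.norm_of_nonneg (by positivity)]
  have n2 : ‖blk₂ w‖ = k * s * ‖blk₂ v‖ := by
    rw [hw₂, norm_smul, Real.norm_of_nonneg (by positivity)]
  have n3 : ‖blk₂ w'‖ = k * s ^ 3 * ‖blk₂ v'‖ := by
    rw [hw₂', norm_smul, Real.norm_of_nonneg (by positivity)]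
  have n4 := norm_le_blk w'
  obtain ⟨ε₁, rfl⟩ : ∃ ε, e₁ = k • ε := ⟨k⁻¹ • e₁, by rw [smul_inv_smul₀ hk.ne']⟩
  obtain ⟨ε₂, rfl⟩ : ∃ ε, e₂ = (k * s) • ε :=
    ⟨(k * s)⁻¹ • e₂, by rw [smul_inv_smul₀ (by positivity)]⟩
  have r1 : ν • (blk₁ v' - blk₁ v) = -(s ^ 2 • blk₁ (H (join (blk₁ v') 0)) + a • blk₁ v'
      + s • blk₁ (H (join 0 (blk₂ v))) + ε₁) := by
    refine smul_right_injective _ hk.ne' ?_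
    rw [hw₁, hw₁', hw₂, hj, blk₁_add, blk₁_smul, blk₁_smul] at h₁
    change k • (ν • (blk₁ v' - blk₁ v)) = k • _
    rw [show k • (ν • (blk₁ v' - blk₁ v)) = ν • ((k * s ^ 2) • blk₁ v' - k • blk₁ v) -
      (k * (ν * (s ^ 2 - 1))) • blk₁ v' by module, h₁, hsa]
    module
  have r2 : ν • (blk₂ v' - blk₂ v) = -(s ^ 2 • blk₂ (H (join 0 (blk₂ v'))) + a • blk₂ v'
      + s • blk₂ (H (join (blk₁ v') 0)) + ε₂) := by
    refine smul_right_injective _ (mul_pos hk hs0).ne' ?_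
    rw [← join_blk w', hw₂, hw₂', hw₁', hj, blk₂_add, blk₂_smul, blk₂_smul, blk₂_join] at h₂
    change (k * s) • (ν • (blk₂ v' - blk₂ v)) = (k * s) • _
    rw [show (k * s) • (ν • (blk₂ v' - blk₂ v)) =
      ν • ((k * s ^ 3) • blk₂ v' - (k * s) • blk₂ v) -
      (k * s * (ν * (s ^ 2 - 1))) • blk₂ v' by module, h₂, hsa]
    module
  have E1 : ‖ε₁‖ ≤ θ * (2 * ‖v'‖ + 2 * ‖v‖) := by
    rw [norm_smul, Real.norm_of_nonneg hk.le, n1, n2] at he₁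
    have : ‖ε₁‖ ≤ θ * (s ^ 2 * ‖blk₁ v'‖ + s * ‖blk₂ v‖) := by
      refine le_of_mul_le_mul_left ?_ hk
      linarith
    refine this.trans ?_
    gcongr
    · exact norm_blk₁_le v'
    · exact norm_blk₂_le v
  have E2 : ‖ε₂‖ ≤ θ * (4 * ‖v'‖) := by
    have hks : 0 < k * s := by positivity
    rw [norm_smul, Real.norm_of_nonneg hks.le] at he₂
    have : ‖ε₂‖ ≤ θ * (s * ‖blk₁ v'‖ + s ^ 2 * ‖blk₂ v'‖) := by
      refine le_of_mul_le_mul_left ?_ hks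
      have := mul_le_mul_of_nonneg_left n4 hθ
      rw [n1, n3] at this
      linarith
    refine this.trans ?_
    have h1 : s * ‖blk₁ v'‖ ≤ 2 * ‖v'‖ := by gcongr; exact norm_blk₁_le v'
    have h2 : s ^ 2 * ‖blk₂ v'‖ ≤ 2 * ‖v'‖ := by gcongr; exact norm_blk₂_le v'
    gcongr
    linarith
  refine (scaledEnergy_step hH hb hM hν hs ha r1 r2).trans ?_
  have S1 := pow_le_pow_left₀ (norm_nonneg _) E1 2
  have S2 := pow_le_pow_left₀ (norm_nonneg _) E2 2
  rw [div_mul_eq_mul_div]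
  gcongr
  nlinarith [mul_nonneg (sq_nonneg θ) (sq_nonneg (‖v'‖ - ‖v‖)),
    mul_nonneg (sq_nonneg θ) (sq_nonneg ‖v‖), mul_nonneg (sq_nonneg θ) (sq_nonneg ‖v'‖)]

/-- Two trajectories that start apart along a direction of negative curvature and both stay close
to the saddle point move apart exponentially. -/
lemma BlockSmooth.growth_le (hf : BlockSmooth f M ρ) (hb : BddBelow (Set.range f))
    (hν : 8 * M ≤ ν) {γ : ℝ} (hγ : 0 < γ) (hγM : γ ≤ M) {z e : Vec m n} (he : ‖e‖ = 1)
    (hneg : ⟪e, hess f z e⟫ ≤ -γ) {x y : Vec m n} {α S : ℝ} (hxy : y - x = α • e) {T : ℕ}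
    (hx : ∀ t ≤ T, ‖(appStep f ν)^[t] x - z‖ ≤ S) (hy : ∀ t ≤ T, ‖(appStep f ν)^[t] y - z‖ ≤ S)
    {R : ℝ} (hR1 : 16 / γ ≤ R) (hR2 : 4 * T / ν ≤ R)
    (hsmall : 4 * (T / ν) * (128 * (ρ * S) ^ 2) * R ≤ 1) :
    (1 + γ / (2 * ν)) ^ (2 * T) * γ * α ^ 2 ≤ 320 * M * S ^ 2 := by
  have hM := hf.pos
  have hρ := hf.rho_pos
  have hν0 : 0 < ν := by linarith
  have hS : 0 ≤ S := (norm_nonneg _).trans (hx 0 (Nat.zero_le _))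
  obtain ⟨s, hs1, hs⟩ : ∃ s : ℝ, 1 ≤ s ∧ s ^ 2 = 1 + γ / (2 * ν) := by
    have h0 : 0 ≤ γ / (2 * ν) := by positivity
    exact ⟨√(1 + γ / (2 * ν)), Real.one_le_sqrt.2 (by linarith), Real.sq_sqrt (by linarith)⟩
  have hs0 : 0 < s := by linarith
  have hsa : ν * (s ^ 2 - 1) = γ / 2 := by rw [hs]; field_simp; ring
  have hs2 : s ^ 2 ≤ 2 := by
    rw [hs]
    have : γ / (2 * ν) ≤ 1 := by rw [div_le_one (by positivity)]; linarith
    linarith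
  have hs21 : 0 ≤ s ^ 2 - 1 := by nlinarith
  let w : ℕ → Vec m n := fun t => (appStep f ν)^[t] y - (appStep f ν)^[t] x
  let v : ℕ → Vec m n := fun t =>
    join ((s ^ (2 * t))⁻¹ • blk₁ (w t)) ((s ^ (2 * t) * s)⁻¹ • blk₂ (w t))
  have hv1 : ∀ t, blk₁ (w t) = s ^ (2 * t) • blk₁ (v t) := fun t => by
    simp only [v, blk₁_join]; rw [smul_inv_smul₀ (by positivity)]
  have hv2 : ∀ t, blk₂ (w t) = (s ^ (2 * t) * s) • blk₂ (v t) := fun t => by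
    simp only [v, blk₂_join]; rw [smul_inv_smul₀ (by positivity)]
  have hH := fun u v => hf.inner_hess_symm z u v
  have hB := fun u v => hf.abs_inner_hess_le z u v
  have hw0 : w 0 = α • e := hxy
  have hnorm0 : ‖w 0‖ ^ 2 = α ^ 2 := by rw [hw0, norm_smul, he, mul_one]; simp
  have hv0 : v 0 = join (blk₁ (w 0)) (s⁻¹ • blk₂ (w 0)) := by simp [v]
  have hE0 : scaledEnergy (hess f z) s (γ / 2) (v 0) ≤ -(γ / 8 * ‖w 0‖ ^ 2) := by
    rw [hv0]
    refine scaledEnergy_le_of_neg_curv hH hB hs1 ?_ (by positivity) le_rfl ?_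
    · rw [← hsa, mul_comm]; gcongr
    · rw [hnorm0, hw0, map_smul, real_inner_smul_left, real_inner_smul_right]
      nlinarith [sq_nonneg α]
  have hn0 : ‖v 0‖ ^ 2 ≤ ‖w 0‖ ^ 2 := by
    rw [norm_sq_eq_blk, norm_sq_eq_blk (w 0), hv0, blk₁_join, blk₂_join, norm_smul]
    have : ‖s⁻¹‖ ≤ 1 := by
      rw [Real.norm_of_nonneg (by positivity)]; exact inv_le_one_of_one_le₀ hs1
    have : ‖s⁻¹‖ * ‖blk₂ (w 0)‖ ≤ ‖blk₂ (w 0)‖ := mul_le_of_le_one_left (norm_nonneg _) this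
    gcongr
  have hmain := half_le_of_increments (q := fun t => -scaledEnergy (hess f z) s (γ / 2) (v t))
    (n := fun t => ‖v t‖) (p := fun t => ‖v (t + 1) - v t‖) (T := T) (R := R) (g := γ / 8)
    (θ := 128 * (ρ * S) ^ 2) hν0 (by positivity) (by positivity) (fun _ => norm_nonneg _)
    (fun k _ => norm_le_norm_add_norm_sub' _ _) ?_ ?_ ?_ hR2 hsmall
  -- The surviving energy `γα²/16` is at most `5M ‖v T‖²`, while localization gives `s^(4T) ‖v T‖² ≤
  -- ‖w T‖² ≤ 4S²`; thus `320 = 16 * 5 * 4`.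
  · have h1 := neg_scaledEnergy_le hB hM hs0.le hs2 (a := γ / 2) (by positivity) (v T)
    have h2 : s ^ (4 * T) * ‖v T‖ ^ 2 ≤ 4 * S ^ 2 := by
      have h3 : s ^ (4 * T) * ‖v T‖ ^ 2 ≤ ‖w T‖ ^ 2 := by
        rw [norm_sq_eq_blk, norm_sq_eq_blk (w T), hv1, hv2, norm_smul, norm_smul,
          Real.norm_of_nonneg (by positivity), Real.norm_of_nonneg (by positivity),
          show s ^ (4 * T) = (s ^ (2 * T)) ^ 2 by ring]
        have h4 : (s ^ (2 * T)) ^ 2 * ‖blk₂ (v T)‖ ^ 2 ≤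
            (s ^ (2 * T)) ^ 2 * ‖blk₂ (v T)‖ ^ 2 * s ^ 2 :=
          le_mul_of_one_le_right (by positivity) (by linarith)
        nlinarith
      have h5 : ‖w T‖ ≤ 2 * S := by
        have h6 := norm_sub_le ((appStep f ν)^[T] y - z) ((appStep f ν)^[T] x - z)
        rw [sub_sub_sub_cancel_right] at h6
        exact h6.trans (by linarith [hx T le_rfl, hy T le_rfl])
      have := pow_le_pow_left₀ (norm_nonneg _) h5 2
      linarith
    have h7 : γ / 16 * α ^ 2 ≤ 5 * M * ‖v T‖ ^ 2 := by
      rw [hnorm0] at hE0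
      linarith
    rw [← hs, ← pow_mul, show 2 * (2 * T) = 4 * T by ring]
    calc s ^ (4 * T) * γ * α ^ 2 = s ^ (4 * T) * (16 * (γ / 16 * α ^ 2)) := by ring
      _ ≤ s ^ (4 * T) * (16 * (5 * M * ‖v T‖ ^ 2)) := by gcongr
      _ = 80 * M * (s ^ (4 * T) * ‖v T‖ ^ 2) := by ring
      _ ≤ 80 * M * (4 * S ^ 2) := by gcongr
      _ = _ := by ring
  · intro k hk
    have hx' := hx (k + 1) hk
    have hy' := hy (k + 1) hk
    rw [Function.iterate_succ_apply'] at hx' hy'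
    obtain ⟨e₁, e₂, h1, h2, h3, h4⟩ := hf.appStep_sub_step hb hν0 (hx k hk.le) (hy k hk.le)
      hx' hy' (w := w k) (w' := w (k + 1)) rfl
      (by simp only [w, Function.iterate_succ_apply'])
    have := rescaled_step hH hB hM hν hs0 hs2 (by positivity) hsa (k := s ^ (2 * k))
      (by positivity) (by positivity) h1 h2 h3 h4 (hv1 k) (hv2 k)
      ((hv1 (k + 1)).trans (by congr 1; ring)) ((hv2 (k + 1)).trans (by congr 1; ring))
    have e5 : 32 * (2 * ρ * S) ^ 2 / ν = 128 * (ρ * S) ^ 2 / ν := by ring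
    rw [e5] at this
    linarith
  · have : γ / 8 * ‖v 0‖ ^ 2 ≤ γ / 8 * ‖w 0‖ ^ 2 := by gcongr
    linarith
  · refine le_trans (le_of_eq ?_) hR1
    field_simp; norm_num

/-- Improve or localize. -/
lemma BlockSmooth.norm_iterate_sub_sq_le (hf : BlockSmooth f M ρ) (hb : BddBelow (Set.range f))
    (hν : 0 < ν) (x : Vec m n) (t : ℕ) :
    ν / 2 * ‖(appStep f ν)^[t] x - x‖ ^ 2 ≤ t * (f x - f ((appStep f ν)^[t] x)) := by
  let u : ℕ → Vec m n := fun k => (appStep f ν)^[k] x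
  have h1 : ∀ k, ν / 2 * ‖u (k + 1) - u k‖ ^ 2 ≤ f (u k) - f (u (k + 1)) := by
    intro k
    have := hf.appStep_le hb hν (u k)
    simp only [u, Function.iterate_succ_apply'] at this ⊢
    linarith
  have h2 : ν / 2 * ∑ k ∈ Finset.range t, ‖u (k + 1) - u k‖ ^ 2 ≤ f (u 0) - f (u t) := by
    rw [Finset.mul_sum, ← Finset.sum_range_sub' (fun k => f (u k))]
    exact Finset.sum_le_sum fun k _ => h1 k
  have h3 : ‖u t - u 0‖ ≤ ∑ k ∈ Finset.range t, ‖u (k + 1) - u k‖ := by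
    rw [← Finset.sum_range_sub]
    exact norm_sum_le _ _
  have h4 : (∑ k ∈ Finset.range t, ‖u (k + 1) - u k‖) ^ 2 ≤
      t * ∑ k ∈ Finset.range t, ‖u (k + 1) - u k‖ ^ 2 := by
    simpa using sq_sum_le_card_mul_sum_sq (s := Finset.range t)
      (f := fun k => ‖u (k + 1) - u k‖)
  have h5 := pow_le_pow_left₀ (norm_nonneg _) h3 2
  calc ν / 2 * ‖u t - u 0‖ ^ 2
      ≤ ν / 2 * (t * ∑ k ∈ Finset.range t, ‖u (k + 1) - u k‖ ^ 2) := by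
        gcongr; exact h5.trans h4
    _ = t * (ν / 2 * ∑ k ∈ Finset.range t, ‖u (k + 1) - u k‖ ^ 2) := by ring
    _ ≤ _ := by gcongr; exact h2

lemma BlockSmooth.iterate_antitone (hf : BlockSmooth f M ρ) (hb : BddBelow (Set.range f))
    (hν : 0 < ν) (x : Vec m n) : Antitone fun t => f ((appStep f ν)^[t] x) := by
  refine antitone_nat_of_succ_le fun t => ?_
  rw [Function.iterate_succ_apply']
  have := hf.appStep_le hb hν ((appStep f ν)^[t] x)
  have : 0 ≤ ν / 2 * ‖appStep f ν ((appStep f ν)^[t] x) - (appStep f ν)^[t] x‖ ^ 2 := by positivity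
  linarith

/-- A trajectory started near `z` along which `f` does not decrease much stays near `z`. -/
lemma BlockSmooth.norm_iterate_sub_le (hf : BlockSmooth f M ρ) (hb : BddBelow (Set.range f))
    (hν : 2 * M ≤ ν) {z ζ : Vec m n} {r g φ F S : ℝ} {T : ℕ} (hg : ‖appStep f ν z - z‖ ≤ g / ν)
    (hζ : ‖ζ‖ ≤ r) (hstuck : -φ < f ((appStep f ν)^[T] (z + ζ)) - f z)
    (hF : 4 * g * r + M * r ^ 2 + φ ≤ F) (hrS : 2 * r ≤ S) (hS : 8 * (T / ν) * F ≤ S ^ 2)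
    {t : ℕ} (ht : t ≤ T) : ‖(appStep f ν)^[t] (z + ζ) - z‖ ≤ S := by
  have hM := hf.pos
  have hν0 : 0 < ν := by linarith
  have hr : 0 ≤ r := (norm_nonneg _).trans hζ
  have hg0 : 0 ≤ g := by
    have := (norm_nonneg _).trans hg
    rwa [le_div_iff₀ hν0, zero_mul] at this
  have h1 : ‖∇ f z‖ ≤ 4 * g := by
    refine (hf.norm_grad_le hb hν z).trans ?_
    calc 4 * ν * ‖appStep f ν z - z‖ ≤ 4 * ν * (g / ν) := by gcongr
      _ = 4 * g := by field_simp
  have h2 : f (z + ζ) ≤ f z + 4 * g * r + M * r ^ 2 := by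
    have h3 := real_inner_le_norm (∇ f z) ζ
    have h4 : ‖∇ f z‖ * ‖ζ‖ ≤ 4 * g * r := by gcongr
    have h5 : M * ‖ζ‖ ^ 2 ≤ M * r ^ 2 := by gcongr
    linarith [hf.descent z ζ]
  have h6 := hf.norm_iterate_sub_sq_le hb hν0 (z + ζ) t
  have h7 := hf.iterate_antitone hb hν0 (z + ζ) ht
  have hanti0 := hf.iterate_antitone hb hν0 (z + ζ) (Nat.zero_le t)
  simp only [Function.iterate_zero_apply] at h7 hanti0
  have h8 : f (z + ζ) - f ((appStep f ν)^[t] (z + ζ)) ≤ F := by linarith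
  -- Half of `S` is for the distance travelled, the other half for the perturbation `ζ`.
  have h9 : ‖(appStep f ν)^[t] (z + ζ) - (z + ζ)‖ ≤ S / 2 := by
    refine le_of_sq_le_sq ?_ (by linarith)
    have htT : (t : ℝ) ≤ T := by exact_mod_cast ht
    have hk : ν / 2 * ‖(appStep f ν)^[t] (z + ζ) - (z + ζ)‖ ^ 2 ≤ T * F :=
      h6.trans (mul_le_mul htT h8 (by linarith) (by positivity))
    have hk2 : ‖(appStep f ν)^[t] (z + ζ) - (z + ζ)‖ ^ 2 ≤ 2 * (T / ν) * F := by
      refine le_of_mul_le_mul_left (hk.trans (le_of_eq ?_)) (half_pos hν0)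
      field_simp
    nlinarith
  have h10 := norm_add_le ((appStep f ν)^[t] (z + ζ) - (z + ζ)) ζ
  rw [show (appStep f ν)^[t] (z + ζ) - (z + ζ) + ζ = (appStep f ν)^[t] (z + ζ) - z by abel] at h10
  linarith

end Escape

/-! ### Volume of sets thin in one direction. -/

section Volume

/-- A subset of a ball which is thin in one direction has small volume: many disjoint translates
of it fit in a slightly larger ball. -/
lemma volume_le_of_thin {E : Type*} [NormedAddCommGroup E] [NormedSpace ℝ E]
    [MeasurableSpace E] [BorelSpace E] [FiniteDimensional ℝ E] (μ : Measure E)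
    [μ.IsAddHaarMeasure] {d K : ℕ} (hd : Module.finrank ℝ E = d) (hd0 : 0 < d) (hK : 0 < K)
    {r : ℝ} (hr : 0 < r) {e : E} (he : ‖e‖ = 1) {W : Set E} (hW : MeasurableSet W)
    (hWr : W ⊆ Metric.closedBall 0 r)
    (hthin : ∀ x ∈ W, ∀ y ∈ W, ∀ α : ℝ, y - x = α • e → α < r / (d * K)) :
    K * μ W ≤ 3 * μ (Metric.closedBall 0 r) := by
  have hd' : (0 : ℝ) < d := by exact_mod_cast hd0
  have hK' : (0 : ℝ) < K := by exact_mod_cast hK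
  set r₀ := r / (d * K) with hr₀
  have hr₀pos : 0 < r₀ := by positivity
  let τ : ℕ → Set E := fun k => (fun x => -((k * r₀) • e) + x) ⁻¹' W
  have hτm : ∀ k, MeasurableSet (τ k) := fun k => (measurable_const_add _) hW
  have hτμ : ∀ k, μ (τ k) = μ W := fun k => measure_preimage_add μ _ W
  have hdisj : Pairwise (Function.onFun Disjoint τ) := by
    have aux : ∀ i j, i < j → Disjoint (τ i) (τ j) := by
      intro i j hij
      rw [Set.disjoint_left]
      intro x hi hj
      have h1 := hthin _ hj _ hi (((j : ℝ) - i) * r₀) (by module)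
      have h2 : (1 : ℝ) ≤ (j : ℝ) - i := by
        have : (i : ℝ) + 1 ≤ j := by exact_mod_cast hij
        linarith
      nlinarith
    intro i j hij
    rcases lt_or_gt_of_ne hij with h | h
    · exact aux i j h
    · exact (aux j i h).symm
  -- All shifts are at most `K r₀ = r/d`, so the enclosing ball gains only a factor `(1 + 1/d)^d ≤
  -- e` in volume. This is why the thinness carries the dimension `d`.
  have hsub : (⋃ k ∈ Finset.range K, τ k) ⊆ Metric.closedBall 0 ((1 + 1 / d) * r) := by
    refine Set.iUnion₂_subset fun k hk x hx => ?_
    have h1 : ‖-((k * r₀) • e) + x‖ ≤ r := by simpa using hWr hx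
    have h2 := norm_add_le ((k * r₀) • e) (-((k * r₀) • e) + x)
    rw [add_neg_cancel_left, norm_smul, he, mul_one, Real.norm_of_nonneg (by positivity)] at h2
    have h3 : k * r₀ ≤ r / d := by
      have : (k : ℝ) ≤ K := by exact_mod_cast (Finset.mem_range.1 hk).le
      calc k * r₀ ≤ K * r₀ := by gcongr
        _ = r / d := by rw [hr₀]; field_simp
    rw [mem_closedBall_zero_iff]
    calc ‖x‖ ≤ r / d + r := by linarith
      _ = _ := by ring
  have hsum : (K : ENNReal) * μ W = μ (⋃ k ∈ Finset.range K, τ k) := by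
    rw [measure_biUnion_finset (fun i _ j _ hij => hdisj hij) fun k _ => hτm k]
    simp [hτμ]
  have hpow : (1 + 1 / (d : ℝ)) ^ d ≤ 3 := by
    have h1 : (1 + 1 / (d : ℝ)) ≤ Real.exp (1 / d) := by
      rw [add_comm]; exact Real.add_one_le_exp _
    calc (1 + 1 / (d : ℝ)) ^ d ≤ Real.exp (1 / d) ^ d := by gcongr
      _ = Real.exp 1 := by rw [← Real.exp_nat_mul]; congr 1; field_simp
      _ ≤ 3 := by linarith [Real.exp_one_lt_d9]
  rw [hsum]
  refine (measure_mono hsub).trans ?_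
  rw [Measure.addHaar_closedBall_mul μ 0 (by positivity) hr.le, hd]
  gcongr
  calc ENNReal.ofReal ((1 + 1 / (d : ℝ)) ^ d) ≤ ENNReal.ofReal 3 := ENNReal.ofReal_le_ofReal hpow
    _ = 3 := by norm_num

lemma cond_closedBall_le_of_thin {E : Type*} [NormedAddCommGroup E] [NormedSpace ℝ E]
    [MeasurableSpace E] [BorelSpace E] [FiniteDimensional ℝ E] (μ : Measure E)
    [μ.IsAddHaarMeasure] {d K : ℕ} (hd : Module.finrank ℝ E = d) (hd0 : 0 < d) (hK : 0 < K)
    {r : ℝ} (hr : 0 < r) {e : E} (he : ‖e‖ = 1) {W : Set E} (hW : MeasurableSet W)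
    (hthin : ∀ x ∈ W, ∀ y ∈ W, ‖x‖ ≤ r → ‖y‖ ≤ r → ∀ α : ℝ, y - x = α • e → α < r / (d * K)) :
    cond μ (Metric.closedBall 0 r) W ≤ 3 / K := by
  rw [cond_apply measurableSet_closedBall]
  have h := volume_le_of_thin μ hd hd0 hK hr he
    (W := Metric.closedBall 0 r ∩ W) (measurableSet_closedBall.inter hW) Set.inter_subset_left
    (fun x hx y hy => hthin x hx.2 y hy.2 (by simpa using hx.1) (by simpa using hy.1))
  have h0 : μ (Metric.closedBall 0 r) ≠ 0 := (Metric.measure_closedBall_pos μ 0 hr).ne'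
  have h1 : μ (Metric.closedBall (0 : E) r) ≠ ⊤ := measure_closedBall_lt_top.ne
  rw [ENNReal.le_div_iff_mul_le (Or.inl (by exact_mod_cast hK.ne')) (Or.inl (by simp))]
  calc (μ (Metric.closedBall 0 r))⁻¹ * μ (Metric.closedBall 0 r ∩ W) * K
      = (μ (Metric.closedBall 0 r))⁻¹ * (K * μ (Metric.closedBall 0 r ∩ W)) := by ring
    _ ≤ (μ (Metric.closedBall 0 r))⁻¹ * (3 * μ (Metric.closedBall 0 r)) := by gcongr
    _ = 3 * ((μ (Metric.closedBall 0 r))⁻¹ * μ (Metric.closedBall 0 r)) := by ring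
    _ = 3 := by rw [ENNReal.inv_mul_cancel h0 h1, mul_one]

end Volume

/-! ### The deterministic course of the algorithm and its termination. -/

section Trajectory

variable {m n : ℕ} {f : Vec m n → ℝ} {ν g φ : ℝ} {τ : ℕ} {ξ : ℕ → Vec m n} {x₀ : Vec m n}

/-- The last perturbation, if any, was more than `τ` iterations before `t`. -/
def Free (τ t : ℕ) (last : Option (ℕ × Vec m n)) : Prop := ∀ q ∈ last, q.1 + τ < t

lemma run_succ_of_free_of_large {t : ℕ} {x : Vec m n} {last : Option (ℕ × Vec m n)}
    (hrun : run f ν g φ τ ξ x₀ t = .running x last) (hfree : Free τ t last)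
    (hg : g / ν < ‖appStep f ν x - x‖) :
    run f ν g φ τ ξ x₀ (t + 1) = .running (appStep f ν x) last := by
  have hnp : ¬ (‖appStep f ν x - x‖ ≤ g / ν ∧ ∀ q ∈ last, q.1 + τ < t) := fun h => by
    linarith [h.1]
  rw [run, hrun]
  rcases last with _ | ⟨tp, xp⟩
  · simp only [iteration, if_neg hnp]
  · have h1 : ¬ (t = tp + τ ∧ f x - f xp > -φ) := fun h => by
      have := hfree (tp, xp) rfl
      simp only at this
      omega
    simp only [iteration, if_neg hnp, if_neg h1]

/-- Positivity of `τ` keeps the stopping check from firing in the iteration of the perturbation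
itself. -/
lemma run_succ_of_perturb {t : ℕ} {x : Vec m n} {last : Option (ℕ × Vec m n)} (hτ : 0 < τ)
    (hrun : run f ν g φ τ ξ x₀ t = .running x last) (hfree : Free τ t last)
    (hg : ‖appStep f ν x - x‖ ≤ g / ν) :
    run f ν g φ τ ξ x₀ (t + 1) = .running (appStep f ν (x + ξ t)) (some (t, x)) := by
  have hp : ‖appStep f ν x - x‖ ≤ g / ν ∧ ∀ q ∈ last, q.1 + τ < t := ⟨hg, hfree⟩
  rw [run, hrun]
  have h1 : ∀ y, ¬ (t = t + τ ∧ f y - f x > -φ) := fun y h => by omega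
  simp only [iteration, if_pos hp, if_neg (h1 _)]

lemma run_succ_of_locked {t tp : ℕ} {x xp : Vec m n}
    (hrun : run f ν g φ τ ξ x₀ t = .running x (some (tp, xp))) (hlock : t ≤ tp + τ) :
    run f ν g φ τ ξ x₀ (t + 1) =
      open Classical in if t = tp + τ ∧ f x - f xp > -φ then .returned tp xp
        else .running (appStep f ν x) (some (tp, xp)) := by
  have hnp : ¬ (‖appStep f ν x - x‖ ≤ g / ν ∧ ∀ q ∈ some (tp, xp), q.1 + τ < t) := fun h => by
    have := h.2 (tp, xp) rfl
    simp only at this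
    omega
  rw [run, hrun]
  simp only [iteration, if_neg hnp]

lemma run_of_perturb {t : ℕ} {x : Vec m n} {last : Option (ℕ × Vec m n)}
    (hrun : run f ν g φ τ ξ x₀ t = .running x last) (hfree : Free τ t last)
    (hg : ‖appStep f ν x - x‖ ≤ g / ν) {j : ℕ} (hj : 0 < j) (hjτ : j ≤ τ) :
    run f ν g φ τ ξ x₀ (t + j) = .running ((appStep f ν)^[j] (x + ξ t)) (some (t, x)) := by
  induction j with
  | zero => omega
  | succ j ih =>
    rcases Nat.eq_zero_or_pos j with rfl | hj0
    · exact run_succ_of_perturb (by omega) hrun hfree hg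
    · have h1 := ih hj0 (by omega)
      have h2 := run_succ_of_locked h1 (by omega)
      rw [← add_assoc, h2, if_neg (fun h => by omega), Function.iterate_succ_apply']

/-- The algorithm either stops at the check after the perturbation of some iterate, or decreases
`f` at a linear rate. -/
lemma exists_returnsAt {M ρ : ℝ} (hf : BlockSmooth f M ρ) (hb : BddBelow (Set.range f))
    (hν : 0 < ν) (hg : 0 < g) {κ : ℝ} (hκ : 0 < κ) (hτ : 0 < τ) (hκg : κ ≤ g ^ 2 / (2 * ν))
    (hκφ : κ * (τ + 1) ≤ φ) :
    ∃ tp x last, run f ν g φ τ ξ x₀ tp = .running x last ∧ ‖appStep f ν x - x‖ ≤ g / ν ∧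
      f x + tp * κ ≤ f x₀ ∧ -φ < f ((appStep f ν)^[τ] (x + ξ tp)) - f x ∧
      ReturnsAt f ν g φ τ ξ x₀ (tp + τ) tp x := by
  by_contra hno
  -- The potential bound is followed only through times at which a perturbation is allowed; inside a
  -- phase the noise may have raised `f`.
  have step : ∀ t x last, run f ν g φ τ ξ x₀ t = .running x last → Free τ t last →
      f x + t * κ ≤ f x₀ → ∃ t' x' last', t < t' ∧
        run f ν g φ τ ξ x₀ t' = .running x' last' ∧ Free τ t' last' ∧ f x' + t' * κ ≤ f x₀ := by
    intro t x last hrun hfree hpot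
    rcases lt_or_ge (g / ν) ‖appStep f ν x - x‖ with hlarge | hsmall
    · refine ⟨t + 1, _, last, Nat.lt_succ_self t, run_succ_of_free_of_large hrun hfree hlarge,
        fun q hq => (hfree q hq).trans (Nat.lt_succ_self t), ?_⟩
      have h1 := hf.appStep_le hb hν x
      have h2 : g ^ 2 / (2 * ν) ≤ ν / 2 * ‖appStep f ν x - x‖ ^ 2 := by
        calc g ^ 2 / (2 * ν) = ν / 2 * (g / ν) ^ 2 := by field_simp
          _ ≤ _ := by gcongr
      push_cast
      linarith
    · have h1 := run_of_perturb hrun hfree hsmall hτ le_rfl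
      have h2 := run_succ_of_locked h1 le_rfl
      by_cases hcheck : -φ < f ((appStep f ν)^[τ] (x + ξ t)) - f x
      · exact absurd ⟨t, x, last, hrun, hsmall, hpot, hcheck, ⟨_, _, h1⟩,
          by rw [h2, if_pos ⟨rfl, hcheck⟩]⟩ hno
      · rw [if_neg (fun h => hcheck h.2), ← Function.iterate_succ_apply' (appStep f ν)] at h2
        -- The failed check at `t + τ` is followed by one more sweep, which does not raise `f`. The
        -- phase therefore costs `τ + 1` iterations, and its gain `φ` is measured from the
        -- unperturbed point.
        refine ⟨t + τ + 1, _, _, by omega, h2, ?_, ?_⟩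
        · intro q hq
          obtain rfl : (t, x) = q := by simpa using hq
          simp
        · have h3 := hf.iterate_antitone hb hν (x + ξ t) (Nat.le_succ τ)
          simp only [Nat.succ_eq_add_one] at h3
          push_cast
          linarith
  have hbig : ∀ N : ℕ, ∃ t x last, N ≤ t ∧ run f ν g φ τ ξ x₀ t = .running x last ∧
      Free τ t last ∧ f x + t * κ ≤ f x₀ := by
    intro N
    induction N with
    | zero => exact ⟨0, x₀, none, le_rfl, rfl, fun q hq => by simp at hq, by simp⟩
    | succ N ih =>
      obtain ⟨t, x, last, hN, h1, h2, h3⟩ := ih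
      obtain ⟨t', x', last', ht, h⟩ := step t x last h1 h2 h3
      exact ⟨t', x', last', by omega, h⟩
  obtain ⟨B, hB⟩ := hb
  obtain ⟨N, hN⟩ := exists_nat_gt ((f x₀ - B) / κ)
  obtain ⟨t, x, last, ht, -, -, h3⟩ := hbig N
  rw [div_lt_iff₀ hκ] at hN
  have h4 : B ≤ f x := hB ⟨x, rfl⟩
  have h5 : (N : ℝ) * κ ≤ t * κ := by gcongr
  linarith

end Trajectory

/-! ### Independence of the noise from the past, and measurability of the run. -/

section Adapted

/-- If `F` depends only on the coordinates before `t`, then `F (ξ)` and `ξ t` are independent, so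
that events about the pair can be estimated by sections. -/
lemma measure_pair_le {Ω E : Type*} [MeasurableSpace Ω] [MeasurableSpace E] [Inhabited E]
    {P : Measure Ω} [IsProbabilityMeasure P] {ξ : ℕ → Ω → E} (hξ : ∀ t, Measurable (ξ t))
    (hind : iIndepFun ξ P) {t : ℕ} {F : (ℕ → E) → E} (hF : Measurable F)
    (hloc : ∀ ζ ζ', (∀ i < t, ζ i = ζ' i) → F ζ = F ζ') {B : Set (E × E)} (hB : MeasurableSet B)
    {δ : ENNReal} (hδ : ∀ x, P.map (ξ t) (Prod.mk x ⁻¹' B) ≤ δ) :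
    P {ω | (F (fun i => ξ i ω), ξ t ω) ∈ B} ≤ δ := by
  -- Filling the later coordinates with a default makes `F` a function of the first `t` noises; by
  -- `hloc` the filling does not matter.
  let ext : (Finset.range t → E) → ℕ → E := fun y i =>
    if h : i ∈ Finset.range t then y ⟨i, h⟩ else default
  have hext : Measurable ext := by
    refine measurable_pi_lambda _ fun i => ?_
    by_cases h : i ∈ Finset.range t
    · simpa only [ext, dif_pos h] using measurable_pi_apply _
    · simpa only [ext, dif_neg h] using measurable_const
  have h1 := hind.indepFun_finset (Finset.range t) {t} (by simp) hξ
  have h2 : IndepFun (fun ω => F (fun i => ξ i ω)) (ξ t) P := by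
    have h3 := h1.comp (hF.comp hext)
      (measurable_pi_apply (⟨t, Finset.mem_singleton_self t⟩ : ({t} : Finset ℕ)))
    refine IndepFun.congr h3 ?_ (Filter.Eventually.of_forall fun ω => rfl)
    refine Filter.Eventually.of_forall fun ω => hloc _ _ fun i hi => ?_
    simp [ext, hi]
  have hX : Measurable fun ω => F (fun i => ξ i ω) := hF.comp (measurable_pi_lambda _ hξ)
  have h4 := (indepFun_iff_map_prod_eq_prod_map_map hX.aemeasurable (hξ t).aemeasurable).1 h2
  have : IsProbabilityMeasure (P.map (ξ t)) := Measure.isProbabilityMeasure_map (hξ t).aemeasurable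
  have : IsProbabilityMeasure (P.map fun ω => F (fun i => ξ i ω)) :=
    Measure.isProbabilityMeasure_map hX.aemeasurable
  calc P {ω | (F (fun i => ξ i ω), ξ t ω) ∈ B}
      = P.map (fun ω => (F (fun i => ξ i ω), ξ t ω)) B :=
        (Measure.map_apply (hX.prodMk (hξ t)) hB).symm
    _ = ∫⁻ x, P.map (ξ t) (Prod.mk x ⁻¹' B) ∂(P.map fun ω => F (fun i => ξ i ω)) := by
        rw [h4, Measure.prod_apply hB]
    _ ≤ ∫⁻ _, δ ∂(P.map fun ω => F (fun i => ξ i ω)) := lintegral_mono hδ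
    _ = δ := by simp

variable {m n : ℕ}

/-- States of the algorithm, encoded as status, time of the last perturbation, iterate and last
perturbed iterate. -/
abbrev Code (m n : ℕ) : Type := ℕ × ℕ × Vec m n × Vec m n

/-- The state encoded by a code. -/
noncomputable def Code.decode : Code m n → State m n
  | (0, _, x, _) => .running x none
  | (1, tp, x, xp) => .running x (some (tp, xp))
  | (_ + 2, tp, _, xp) => .returned tp xp

/-- The code after a possible perturbation. -/
noncomputable def Code.perturb (f : Vec m n → ℝ) (ν g : ℝ) (τ t : ℕ) (ζ : Vec m n)
    (s : Code m n) : Code m n :=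
  open Classical in
  if s.1 < 2 ∧ ‖appStep f ν s.2.2.1 - s.2.2.1‖ ≤ g / ν ∧ (s.1 = 0 ∨ s.2.1 + τ < t) then
    (1, t, s.2.2.1 + ζ, s.2.2.1) else s

/-- The code after the check and the sweep. -/
noncomputable def Code.sweep (f : Vec m n → ℝ) (ν φ : ℝ) (τ t : ℕ) (s : Code m n) : Code m n :=
  open Classical in
  if 2 ≤ s.1 then s else
  if s.1 = 1 ∧ t = s.2.1 + τ ∧ -φ < f s.2.2.1 - f s.2.2.2 then (2, s.2) else
    (s.1, s.2.1, appStep f ν s.2.2.1, s.2.2.2)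

/-- The encoded run of the algorithm. -/
noncomputable def codeRun (f : Vec m n → ℝ) (ν g φ : ℝ) (τ : ℕ) (x₀ : Vec m n)
    (ξ : ℕ → Vec m n) : ℕ → Code m n
  | 0 => (0, 0, x₀, 0)
  | t + 1 => ((codeRun f ν g φ τ x₀ ξ t).perturb f ν g τ t (ξ t)).sweep f ν φ τ t

variable {f : Vec m n → ℝ} {ν g φ : ℝ} {τ : ℕ} {x₀ : Vec m n}

lemma Code.decode_zero (tp : ℕ) (x xp : Vec m n) :
    Code.decode (0, tp, x, xp) = .running x none := rfl

lemma Code.decode_one (tp : ℕ) (x xp : Vec m n) :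
    Code.decode (1, tp, x, xp) = .running x (some (tp, xp)) := rfl

lemma Code.decode_add_two (k tp : ℕ) (x xp : Vec m n) :
    Code.decode (k + 2, tp, x, xp) = .returned tp xp := rfl

lemma Code.decode_two (tp : ℕ) (x xp : Vec m n) :
    Code.decode (2, tp, x, xp) = .returned tp xp := rfl

lemma Code.sweep_zero (t tp : ℕ) (x xp : Vec m n) :
    Code.sweep f ν φ τ t (0, tp, x, xp) = (0, tp, appStep f ν x, xp) := by
  simp [Code.sweep]

lemma Code.decode_sweep_one (t tp : ℕ) (x xp : Vec m n) :
    (Code.sweep f ν φ τ t (1, tp, x, xp)).decode =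
      open Classical in if t = tp + τ ∧ f x - f xp > -φ then State.returned tp xp
        else .running (appStep f ν x) (some (tp, xp)) := by
  have h2 : ¬ (2 ≤ 1) := by omega
  simp only [Code.sweep, if_neg h2]
  by_cases hC : t = tp + τ ∧ f x - f xp > -φ
  · rw [if_pos hC, if_pos ⟨trivial, hC⟩, Code.decode_two]
  · rw [if_neg hC, if_neg (fun h => hC h.2), Code.decode_one]

lemma decode_step (t : ℕ) (ξ : ℕ → Vec m n) (s : Code m n) :
    ((s.perturb f ν g τ t (ξ t)).sweep f ν φ τ t).decode =
      iteration f ν g φ τ ξ t s.decode := by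
  obtain ⟨k, tp, x, xp⟩ := s
  obtain rfl | rfl | ⟨k, rfl⟩ : k = 0 ∨ k = 1 ∨ ∃ j, k = j + 2 := by
    rcases k with _ | _ | k
    · simp
    · simp
    · exact Or.inr (Or.inr ⟨k, rfl⟩)
  · rw [Code.decode_zero]
    by_cases hp : ‖appStep f ν x - x‖ ≤ g / ν ∧ ∀ q ∈ (none : Option (ℕ × Vec m n)), q.1 + τ < t
    · rw [Code.perturb, if_pos ⟨Nat.zero_lt_two, hp.1, Or.inl rfl⟩, Code.decode_sweep_one]
      simp only [iteration, if_pos hp]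
    · rw [Code.perturb, if_neg (fun h => hp ⟨h.2.1, by simp⟩), Code.sweep_zero, Code.decode_zero]
      simp only [iteration, if_neg hp]
  · rw [Code.decode_one]
    by_cases hp : ‖appStep f ν x - x‖ ≤ g / ν ∧ ∀ q ∈ some (tp, xp), q.1 + τ < t
    · rw [Code.perturb, if_pos ⟨Nat.one_lt_two, hp.1, Or.inr (hp.2 (tp, xp) rfl)⟩,
        Code.decode_sweep_one]
      simp only [iteration, if_pos hp]
    · rw [Code.perturb, if_neg (fun h => hp ⟨h.2.1, by simpa using h.2.2⟩), Code.decode_sweep_one]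
      simp only [iteration, if_neg hp]
  · simp [Code.decode_add_two, Code.perturb, Code.sweep, iteration]

/-- Codes live in a product of measurable spaces, so measurability is proved for them and the run is
recovered by decoding. -/
lemma decode_codeRun (ξ : ℕ → Vec m n) (t : ℕ) :
    (codeRun f ν g φ τ x₀ ξ t).decode = run f ν g φ τ ξ x₀ t := by
  induction t with
  | zero => rfl
  | succ t ih => rw [codeRun, run, decode_step, ih]

lemma codeRun_pos_of_run {ξ : ℕ → Vec m n} {t : ℕ} {x : Vec m n} {last : Option (ℕ × Vec m n)}
    (h : run f ν g φ τ ξ x₀ t = .running x last) : (codeRun f ν g φ τ x₀ ξ t).2.2.1 = x := by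
  rw [← decode_codeRun] at h
  generalize codeRun f ν g φ τ x₀ ξ t = s at h ⊢
  obtain ⟨k, tp, y, yp⟩ := s
  obtain rfl | rfl | ⟨k, rfl⟩ : k = 0 ∨ k = 1 ∨ ∃ j, k = j + 2 := by
    rcases k with _ | _ | k
    · simp
    · simp
    · exact Or.inr (Or.inr ⟨k, rfl⟩)
  · rw [Code.decode_zero, State.running.injEq] at h
    exact h.1
  · rw [Code.decode_one, State.running.injEq] at h
    exact h.1
  · rw [Code.decode_add_two] at h
    cases h

/-- Adaptedness, as required by `measure_pair_le`: the noise `ξ t` enters only after time `t`. -/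
lemma codeRun_congr {ξ ξ' : ℕ → Vec m n} {t : ℕ} (h : ∀ i < t, ξ i = ξ' i) :
    codeRun f ν g φ τ x₀ ξ t = codeRun f ν g φ τ x₀ ξ' t := by
  induction t with
  | zero => rfl
  | succ t ih => rw [codeRun, codeRun, ih fun i hi => h i (by omega), h t (by omega)]

lemma measurable_perturb (hA : Measurable (appStep f ν)) (t : ℕ) :
    Measurable fun p : Code m n × Vec m n => p.1.perturb f ν g τ t p.2 := by
  have hk : Measurable fun p : Code m n × Vec m n => p.1.1 := by fun_prop
  have ht : Measurable fun p : Code m n × Vec m n => p.1.2.1 := by fun_prop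
  have hx : Measurable fun p : Code m n × Vec m n => p.1.2.2.1 := by fun_prop
  refine Measurable.ite ?_ (by fun_prop) (by fun_prop)
  refine (measurableSet_lt hk measurable_const).inter
    ((measurableSet_le ((hA.comp hx).sub hx).norm measurable_const).inter
    ((measurableSet_eq_fun hk measurable_const).union
      (measurableSet_lt (ht.add_const τ) measurable_const)))

lemma measurable_sweep (hA : Measurable (appStep f ν)) (hf : Measurable f) (t : ℕ) :
    Measurable fun p : Code m n => p.sweep f ν φ τ t := by
  have hk : Measurable fun p : Code m n => p.1 := by fun_prop
  have ht : Measurable fun p : Code m n => p.2.1 := by fun_prop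
  have hx : Measurable fun p : Code m n => p.2.2.1 := by fun_prop
  have hxp : Measurable fun p : Code m n => p.2.2.2 := by fun_prop
  refine Measurable.ite (measurableSet_le measurable_const hk) measurable_id ?_
  refine Measurable.ite ?_ (by fun_prop) (by fun_prop)
  exact (measurableSet_eq_fun hk measurable_const).inter
    ((measurableSet_eq_fun measurable_const (ht.add_const τ)).inter
      (measurableSet_lt measurable_const ((hf.comp hx).sub (hf.comp hxp))))

lemma measurable_codeRun (hA : Measurable (appStep f ν)) (hf : Measurable f) (t : ℕ) :
    Measurable fun ξ => codeRun f ν g φ τ x₀ ξ t := by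
  induction t with
  | zero => exact measurable_const
  | succ t ih =>
    exact (measurable_sweep hA hf t).comp
      ((measurable_perturb hA t).comp (ih.prodMk (measurable_pi_apply t)))

end Adapted

/-! ### Numerical relations between the parameters. -/

section Parameters

lemma exp_half_le_one_add {x : ℝ} (h0 : 0 ≤ x) (h1 : x ≤ 1) : Real.exp (x / 2) ≤ 1 + x := by
  have h2 : 1 - x / 2 ≤ Real.exp (-(x / 2)) := Real.one_sub_le_exp_neg _
  have h3 : Real.exp (x / 2) * Real.exp (-(x / 2)) = 1 := by rw [← Real.exp_add]; simp
  have h4 : 0 < Real.exp (x / 2) := Real.exp_pos _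
  have h5 : Real.exp (x / 2) * (1 - x / 2) ≤ 1 :=
    (mul_le_mul_of_nonneg_left h2 h4.le).trans h3.le
  nlinarith

/-- Constraints on the problem constants and the parameters of the algorithm. -/
structure Regime (M ρ ε γ c χ P : ℝ) : Prop where
  M_pos : 0 < M
  ρ_pos : 0 < ρ
  ε_pos : 0 < ε
  γ_pos : 0 < γ
  γ_le : γ ≤ M
  γ_cube : γ ^ 3 = M * ρ * ε
  c_pos : 0 < c
  c_le : c ≤ 1 / 100
  χ_ge : 24 ≤ χ
  P_ge : 1 ≤ P

variable {M ρ ε γ c χ P : ℝ}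

lemma Regime.time_ge (h : Regime M ρ ε γ c χ P) : 24 ≤ M * χ / (c ^ 2 * γ) := by
  obtain ⟨hM, hρ, hε, hγ, hγM, hγ3, hc, hc1, hχ, hP⟩ := h
  have h1 : c ^ 2 ≤ 1 := pow_le_one₀ hc.le (by linarith)
  rw [le_div_iff₀ (by positivity)]
  have h2 : c ^ 2 * γ ≤ 1 * M := by gcongr
  nlinarith

lemma Regime.ceil_time_le (h : Regime M ρ ε γ c χ P) :
    (⌈M * χ / (c ^ 2 * γ)⌉₊ : ℝ) + 1 ≤ 2 * (M * χ / (c ^ 2 * γ)) := by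
  have h1 := h.time_ge
  have h2 := Nat.ceil_lt_add_one (show 0 ≤ M * χ / (c ^ 2 * γ) by linarith)
  linarith

/-- The exponent `χ/(2c)` is split in halves. One pays for `(1/c)^6`, as `6 ≤ χ/4`. The other is at
least `25χ` and pays for `G⁴ ≤ exp χ` and for the powers of `χ`, which cost `exp(22χ)`. -/
lemma exp_growth {Y D G : ℝ} (hc : 0 < c) (hc1 : c ≤ 1 / 100) (hχ : 24 ≤ χ) (hY0 : 0 ≤ Y)
    (hG : G ≤ Real.exp (χ / 6)) (hY : Y ≤ 6 * G) (hD0 : 0 ≤ D) (hD : D ≤ 12 * χ ^ 7 * G / c ^ 2) :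
    32000 * Y ^ 2 * χ ^ 2 * D ^ 2 < c ^ 2 * Real.exp (χ / (2 * c)) := by
  have hG0 : 0 ≤ G := by linarith
  have hχ0 : 0 < χ := by linarith
  have e1 : G ^ 4 ≤ Real.exp χ := by
    calc G ^ 4 ≤ Real.exp (χ / 6) ^ 4 := by gcongr
      _ = Real.exp (4 * (χ / 6)) := by rw [← Real.exp_nat_mul]; norm_num
      _ ≤ Real.exp χ := by gcongr; linarith
  have e2 : 165888000 * χ ^ 16 ≤ Real.exp (22 * χ) := by
    have h1 : (165888000 : ℝ) ≤ χ ^ 6 := by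
      calc (165888000 : ℝ) ≤ 24 ^ 6 := by norm_num
        _ ≤ χ ^ 6 := by gcongr
    have h2 : χ ≤ Real.exp χ := by linarith [Real.add_one_le_exp χ]
    calc 165888000 * χ ^ 16 ≤ χ ^ 6 * χ ^ 16 := by gcongr
      _ = χ ^ 22 := by ring
      _ ≤ Real.exp χ ^ 22 := by gcongr
      _ = Real.exp (22 * χ) := by rw [← Real.exp_nat_mul]; norm_num
  have e3 : (1 / c) ^ 6 < Real.exp (χ / (4 * c)) := by
    have h1 : 1 / c < Real.exp (1 / c) := by linarith [Real.add_one_le_exp (1 / c)]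
    calc (1 / c) ^ 6 < Real.exp (1 / c) ^ 6 := by gcongr
      _ = Real.exp (6 * (1 / c)) := by rw [← Real.exp_nat_mul]; norm_num
      _ ≤ Real.exp (χ / (4 * c)) := by
        gcongr
        rw [le_div_iff₀ (by positivity)]
        field_simp
        linarith
  have e4 : Real.exp (22 * χ) * Real.exp χ ≤ Real.exp (χ / (4 * c)) := by
    rw [← Real.exp_add]
    gcongr
    rw [le_div_iff₀ (by positivity)]
    nlinarith
  have e5 : Real.exp (χ / (4 * c)) * Real.exp (χ / (4 * c)) = Real.exp (χ / (2 * c)) := by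
    rw [← Real.exp_add]; congr 1; field_simp; norm_num
  calc 32000 * Y ^ 2 * χ ^ 2 * D ^ 2
      ≤ 32000 * (6 * G) ^ 2 * χ ^ 2 * (12 * χ ^ 7 * G / c ^ 2) ^ 2 := by gcongr
    _ = c ^ 2 * (165888000 * χ ^ 16 * G ^ 4 * (1 / c) ^ 6) := by field_simp; ring
    _ ≤ c ^ 2 * (Real.exp (22 * χ) * Real.exp χ * (1 / c) ^ 6) := by gcongr
    _ < c ^ 2 * (Real.exp (22 * χ) * Real.exp χ * Real.exp (χ / (4 * c))) := by gcongr
    _ ≤ c ^ 2 * (Real.exp (χ / (4 * c)) * Real.exp (χ / (4 * c))) := by gcongr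
    _ = _ := by rw [e5]

/-- The radius within which trajectories that do not escape stay. -/
lemma Regime.exists_localization_radius (h : Regime M ρ ε γ c χ P) {r g φ ν : ℝ}
    (hr : r = c ^ 3 * ε / (χ ^ 3 * M * P)) (hg : g = c ^ 2 * ε / (χ ^ 3 * P))
    (hφ : φ = c ^ 5 * ε ^ 2 / (M * χ ^ 6 * P ^ 2)) (hν : ν = M / c)
    {τ : ℕ} (hτν : τ / ν ≤ 2 * χ / (c * γ)) :
    ∃ S, 0 < S ∧ S ^ 2 = 100 * c ^ 4 * ε ^ 2 / (γ * M * χ ^ 4 * P ^ 2) ∧ 2 * r ≤ S ∧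
      4 * g * r + M * r ^ 2 + φ ≤ 6 * φ ∧ 8 * (τ / ν) * (6 * φ) ≤ S ^ 2 ∧
      4 * (τ / ν) * (128 * (ρ * S) ^ 2) * (8 * χ / (c * γ)) ≤ 1 := by
  obtain ⟨hM, hρ, hε, hγ, hγM, hγ3, hc, hc1, hχ, hP⟩ := h
  have hχ0 : 0 < χ := by linarith
  have hP0 : 0 < P := by linarith
  have hν0 : 0 < ν := by rw [hν]; positivity
  obtain ⟨q, hq0, hq⟩ : ∃ q : ℝ, 0 < q ∧ q ^ 2 = γ * M :=
    ⟨√(γ * M), Real.sqrt_pos.2 (by positivity), Real.sq_sqrt (by positivity)⟩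
  have hqM : q ≤ M := by
    refine le_of_sq_le_sq ?_ hM.le
    rw [hq]; nlinarith
  obtain ⟨S, hS⟩ : ∃ S : ℝ, S = 10 * c ^ 2 * ε / (q * χ ^ 2 * P) := ⟨_, rfl⟩
  have hS0 : 0 < S := by rw [hS]; positivity
  have hS2 : S ^ 2 = 100 * c ^ 4 * ε ^ 2 / (γ * M * χ ^ 4 * P ^ 2) := by
    rw [hS, ← hq, div_pow]; congr 1 <;> ring
  have hrpos : 0 < r := by rw [hr]; positivity
  have hφpos : 0 < φ := by rw [hφ]; positivity
  have hrS : 2 * r ≤ S := by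
    have e1 : 2 * r = 2 * c * (c ^ 2 * ε / (M * χ ^ 2 * P)) / χ := by rw [hr]; field_simp
    have e2 : S = 10 * (c ^ 2 * ε / (q * χ ^ 2 * P)) := by rw [hS]; ring
    rw [e1, e2, div_le_iff₀ hχ0]
    have e3 : c ^ 2 * ε / (M * χ ^ 2 * P) ≤ c ^ 2 * ε / (q * χ ^ 2 * P) := by gcongr
    calc 2 * c * (c ^ 2 * ε / (M * χ ^ 2 * P)) ≤ 10 * (c ^ 2 * ε / (M * χ ^ 2 * P)) := by
          gcongr; linarith
      _ ≤ 10 * (c ^ 2 * ε / (q * χ ^ 2 * P)) := by gcongr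
      _ ≤ _ := le_mul_of_one_le_right (by positivity) (by linarith)
  have hF : 4 * g * r + M * r ^ 2 + φ ≤ 6 * φ := by
    have e1 : g * r = φ := by rw [hg, hr, hφ]; field_simp
    have e2 : M * r ^ 2 = c * φ := by rw [hr, hφ]; field_simp
    have e3 : c * φ ≤ 1 * φ := by gcongr; linarith
    linarith
  have hSF : 8 * (τ / ν) * (6 * φ) ≤ S ^ 2 := by
    calc 8 * (τ / ν) * (6 * φ) ≤ 8 * (2 * χ / (c * γ)) * (6 * φ) := by gcongr
      _ = 96 * c ^ 4 * ε ^ 2 / (γ * M * χ ^ 4 * P ^ 2) / χ := by rw [hφ]; field_simp; ring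
      _ ≤ 96 * c ^ 4 * ε ^ 2 / (γ * M * χ ^ 4 * P ^ 2) := div_le_self (by positivity) (by linarith)
      _ ≤ S ^ 2 := by rw [hS2]; gcongr; norm_num
  have hsmall : 4 * (τ / ν) * (128 * (ρ * S) ^ 2) * (8 * χ / (c * γ)) ≤ 1 := by
    -- The choice of `γ` enters here: it turns the accumulated linearization error into a multiple
    -- of `c² (γ/M)³ / (χ² P²)`.
    have e0 : (ρ * ε) = γ ^ 3 / M := by rw [hγ3]; field_simp
    calc 4 * (τ / ν) * (128 * (ρ * S) ^ 2) * (8 * χ / (c * γ))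
        ≤ 4 * (2 * χ / (c * γ)) * (128 * (ρ * S) ^ 2) * (8 * χ / (c * γ)) := by gcongr
      _ = 819200 * c ^ 2 * (ρ * ε) ^ 2 / (γ ^ 3 * M * χ ^ 2 * P ^ 2) := by
          rw [mul_pow, hS2]; field_simp; ring
      _ = 819200 * c ^ 2 * (γ / M) ^ 3 / (χ ^ 2 * P ^ 2) := by rw [e0]; field_simp
      _ ≤ 819200 * (1 / 100) ^ 2 * 1 ^ 3 / (24 ^ 2 * 1 ^ 2) := by
          gcongr
          rw [div_le_one hM]; exact hγM
      _ ≤ 1 := by norm_num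
  exact ⟨S, hS0, hS2, hrS, hF, hSF, hsmall⟩

end Parameters

/-! ### Stuck perturbations near a point of negative curvature. -/

section Saddle

variable {m n : ℕ} {f : Vec m n → ℝ} {M ρ ε γ c χ P : ℝ}

/-- Perturbations from which the method does not escape a saddle point within the allotted time
differ little in the direction of negative curvature. -/
lemma BlockSmooth.stuck_thin (hf : BlockSmooth f M ρ) (hb : BddBelow (Set.range f))
    (h : Regime M ρ ε γ c χ P) {D : ℝ} (hD0 : 0 < D)
    (hgrow : 32000 * (M / γ) ^ 2 * χ ^ 2 * D ^ 2 < c ^ 2 * Real.exp (χ / (2 * c)))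
    {r g φ ν : ℝ} (hr : r = c ^ 3 * ε / (χ ^ 3 * M * P)) (hg : g = c ^ 2 * ε / (χ ^ 3 * P))
    (hφ : φ = c ^ 5 * ε ^ 2 / (M * χ ^ 6 * P ^ 2)) (hν : ν = M / c)
    {τ : ℕ} (hτ : τ = ⌈M * χ / (c ^ 2 * γ)⌉₊) {z e : Vec m n}
    (hz : ‖appStep f ν z - z‖ ≤ g / ν) (he : ‖e‖ = 1) (hneg : ⟪e, hess f z e⟫ ≤ -γ)
    {x y : Vec m n} (hx : ‖x‖ ≤ r) (hy : ‖y‖ ≤ r)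
    (hxs : -φ < f ((appStep f ν)^[τ] (z + x)) - f z)
    (hys : -φ < f ((appStep f ν)^[τ] (z + y)) - f z) {α : ℝ} (hα : y - x = α • e) :
    α < r / D := by
  have htime := h.ceil_time_le
  rw [← hτ] at htime
  have hτ2 : M * χ / (c ^ 2 * γ) ≤ τ := by rw [hτ]; exact Nat.le_ceil _
  have hτν : τ / ν ≤ 2 * χ / (c * γ) := by
    have hc := h.c_pos
    have hM := h.M_pos
    have hγ := h.γ_pos
    rw [div_le_iff₀ (by rw [hν]; positivity)]
    calc (τ : ℝ) ≤ 2 * (M * χ / (c ^ 2 * γ)) := by linarith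
      _ = 2 * χ / (c * γ) * ν := by rw [hν]; field_simp
  obtain ⟨S, hS0, hS2, hrS, hF, hSF, hsmall⟩ := h.exists_localization_radius hr hg hφ hν hτν
  obtain ⟨hM, hρ, hε, hγ, hγM, hγ3, hc, hc1, hχ, hP⟩ := h
  have hχ0 : 0 < χ := by linarith
  have hP0 : 0 < P := by linarith
  have hν8 : 8 * M ≤ ν := by
    rw [hν, le_div_iff₀ hc]; nlinarith
  have hν0 : 0 < ν := by linarith
  have hrpos : 0 < r := by rw [hr]; positivity
  have loc : ∀ ζ : Vec m n, ‖ζ‖ ≤ r → -φ < f ((appStep f ν)^[τ] (z + ζ)) - f z →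
      ∀ t ≤ τ, ‖(appStep f ν)^[t] (z + ζ) - z‖ ≤ S := fun ζ hζ hs t ht =>
    hf.norm_iterate_sub_le hb (by linarith) hz hζ hs hF hrS hSF ht
  by_contra! hlt
  have hαpos : 0 ≤ α := le_trans (by positivity) hlt
  have key := hf.growth_le hb hν8 hγ hγM he hneg (x := z + x) (y := z + y) (α := α) (S := S)
    (by rw [add_sub_add_left_eq_sub, hα]) (T := τ) (loc x hx hxs) (loc y hy hys)
    (R := 8 * χ / (c * γ))
    (by
      rw [div_le_div_iff₀ hγ (by positivity)]
      have : 16 * c ≤ 8 * χ := by linarith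
      calc 16 * (c * γ) = 16 * c * γ := by ring
        _ ≤ 8 * χ * γ := by gcongr)
    (by
      calc 4 * (τ : ℝ) / ν = 4 * (τ / ν) := by ring
        _ ≤ 4 * (2 * χ / (c * γ)) := by gcongr
        _ = _ := by ring) hsmall
  have hexp : Real.exp (χ / (2 * c)) ≤ (1 + γ / (2 * ν)) ^ (2 * τ) := by
    have e1 : γ / (2 * ν) ≤ 1 := by rw [div_le_one (by positivity)]; linarith
    calc Real.exp (χ / (2 * c)) ≤ Real.exp (((2 * τ : ℕ) : ℝ) * (γ / (2 * ν) / 2)) := by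
          gcongr
          push_cast
          calc χ / (2 * c) = M * χ / (c ^ 2 * γ) * (γ / (2 * ν)) := by rw [hν]; field_simp
            _ ≤ τ * (γ / (2 * ν)) := by gcongr
            _ = _ := by ring
      _ = Real.exp (γ / (2 * ν) / 2) ^ (2 * τ) := Real.exp_nat_mul _ _
      _ ≤ _ := by
          gcongr
          exact exp_half_le_one_add (by positivity) e1
  have h1 : Real.exp (χ / (2 * c)) * γ * (r / D) ^ 2 ≤ 320 * M * S ^ 2 := by
    refine le_trans ?_ key
    gcongr
  rw [hS2, hr] at h1
  have h2 : Real.exp (χ / (2 * c)) * γ * (c ^ 3 * ε / (χ ^ 3 * M * P) / D) ^ 2 =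
      (c ^ 2 * Real.exp (χ / (2 * c))) *
        (c ^ 4 * ε ^ 2 * γ / (χ ^ 6 * M ^ 2 * P ^ 2 * D ^ 2)) := by
    field_simp
  have h3 : 320 * M * (100 * c ^ 4 * ε ^ 2 / (γ * M * χ ^ 4 * P ^ 2)) =
      (32000 * (M / γ) ^ 2 * χ ^ 2 * D ^ 2) *
        (c ^ 4 * ε ^ 2 * γ / (χ ^ 6 * M ^ 2 * P ^ 2 * D ^ 2)) := by
    field_simp; norm_num
  rw [h2, h3] at h1
  have h4 : 0 < c ^ 4 * ε ^ 2 * γ / (χ ^ 6 * M ^ 2 * P ^ 2 * D ^ 2) := by positivity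
  linarith [le_of_mul_le_mul_right h1 h4]

/-- Points where the Hessian has a direction of curvature less than `-γ`. -/
def NegCurv (f : Vec m n → ℝ) (γ : ℝ) (x : Vec m n) : Prop :=
  ∃ e : Vec m n, ‖e‖ = 1 ∧ ⟪e, hess f x e⟫ < -γ

lemma neg_le_lambdaMin {x : Vec m n} (hγ : 0 ≤ γ) (h : ¬ NegCurv f γ x) :
    -γ ≤ lambdaMin (hess f x) := by
  rw [lambdaMin]
  rcases Set.eq_empty_or_nonempty
    {μ : ℝ | Module.End.HasEigenvalue (hess f x : Vec m n →ₗ[ℝ] Vec m n) μ} with h0 | h0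
  -- The infimum of the empty set is `0`, so existence of eigenvalues need not be discussed.
  · rw [h0, Real.sInf_empty]; linarith
  · refine le_csInf h0 fun μ hμ => ?_
    obtain ⟨v, hv⟩ := hμ.exists_hasEigenvector
    have hv0 : ‖v‖ ≠ 0 := norm_ne_zero_iff.2 hv.2
    have hv1 : hess f x v = μ • v := hv.apply_eq_smul
    by_contra! hlt
    refine h ⟨‖v‖⁻¹ • v, by rw [norm_smul, norm_inv, norm_norm, inv_mul_cancel₀ hv0], ?_⟩
    rw [map_smul, hv1, real_inner_smul_left, real_inner_smul_right, real_inner_smul_right,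
      real_inner_self_eq_norm_sq]
    calc ‖v‖⁻¹ * (‖v‖⁻¹ * (μ * ‖v‖ ^ 2)) = μ := by field_simp
      _ < -γ := hlt

lemma negCurv_of_lambdaMin_lt {x : Vec m n} (hγ : 0 ≤ γ) (h : lambdaMin (hess f x) < -γ) :
    NegCurv f γ x := by
  by_contra hn
  linarith [neg_le_lambdaMin hγ hn]

/-- A union of open conditions over unit vectors, by continuity of the Hessian; this supplies the
measurability of `stuckSet`. -/
lemma BlockSmooth.isOpen_negCurv (hf : BlockSmooth f M ρ) : IsOpen {x | NegCurv f γ x} := by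
  have hc : Continuous (hess f) := by
    refine (LipschitzWith.of_dist_le_mul (K := ⟨ρ, hf.rho_pos.le⟩) fun x y => ?_).continuous
    rw [dist_eq_norm, dist_eq_norm]
    exact hf.hessLip x y
  have : {x | NegCurv f γ x} = ⋃ e ∈ Metric.sphere (0 : Vec m n) 1,
      {x | ⟪e, hess f x e⟫ < -γ} := by
    ext x; simp [NegCurv]
  rw [this]
  refine isOpen_biUnion fun e _ => ?_
  exact isOpen_lt (continuous_const.inner (hc.clm_apply continuous_const)) continuous_const

lemma BlockSmooth.gap_of_negCurv (hf : BlockSmooth f M ρ) (hb : BddBelow (Set.range f))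
    (h : Regime M ρ ε γ c χ P) {x x₀ : Vec m n} (hx : NegCurv f γ x) (hle : f x ≤ f x₀) :
    M * ε / (6 * ρ) ≤ gap f x₀ := by
  obtain ⟨e, he, hneg⟩ := hx
  obtain ⟨y, hy⟩ := hf.exists_le_of_neg_curv h.γ_pos x e he hneg.le
  have h1 : ⨅ x, f x ≤ f y := ciInf_le hb y
  have h2 : γ ^ 3 / (6 * ρ ^ 2) = M * ε / (6 * ρ) := by
    have := h.ρ_pos
    rw [h.γ_cube]; field_simp
  rw [gap]; linarith

end Saddle

/-! ### The constants of the statement, and the iteration bounds. -/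

section Constants

variable {M ρ ε : ℝ}

lemma gam_pos (hM : 0 < M) (hρ : 0 < ρ) (hε : 0 < ε) : 0 < gam M ρ ε := by
  unfold gam; positivity

lemma gam_cube (hM : 0 < M) (hρ : 0 < ρ) (hε : 0 < ε) : gam M ρ ε ^ 3 = M * ρ * ε := by
  rw [gam, ← Real.rpow_natCast, ← Real.rpow_mul (by positivity)]
  norm_num

lemma gam_le (hM : 0 < M) (hρ : 0 < ρ) (hε : 0 < ε) (h : ε ≤ M ^ 2 / ρ) : gam M ρ ε ≤ M := by
  refine le_of_pow_le_pow_left₀ three_ne_zero hM.le ?_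
  rw [gam_cube hM hρ hε]
  rw [le_div_iff₀ hρ] at h
  nlinarith

lemma rpow_rate_eq (hM : 0 < M) (hρ : 0 < ρ) (hε : 0 < ε) :
    M ^ (5 / 3 : ℝ) / (ρ ^ (1 / 3 : ℝ) * ε ^ (7 / 3 : ℝ)) = M ^ 2 / (gam M ρ ε * ε ^ 2) := by
  have h1 : M ^ 2 = M ^ (5 / 3 : ℝ) * M ^ (1 / 3 : ℝ) := by
    rw [← Real.rpow_add hM, ← Real.rpow_natCast]; norm_num
  have h2 : ε ^ (7 / 3 : ℝ) = ε ^ (1 / 3 : ℝ) * ε ^ 2 := by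
    rw [← Real.rpow_natCast ε 2, ← Real.rpow_add hε]; norm_num
  rw [gam, Real.mul_rpow (by positivity) hε.le, Real.mul_rpow hM.le hρ.le, h1, h2,
    div_eq_div_iff (by positivity) (by positivity)]
  ring

lemma rate_eq {d : ℕ} {L Δ : ℝ} (hM : 0 < M) (hρ : 0 < ρ) (hε : 0 < ε) :
    rate d L M ρ ε Δ = M ^ 2 * calP d L M ^ 2 * Δ / (gam M ρ ε * ε ^ 2) := by
  rw [rate, show M ^ (5 / 3 : ℝ) * calP d L M ^ 2 * Δ / (ρ ^ (1 / 3 : ℝ) * ε ^ (7 / 3 : ℝ)) =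
    M ^ (5 / 3 : ℝ) / (ρ ^ (1 / 3 : ℝ) * ε ^ (7 / 3 : ℝ)) * (calP d L M ^ 2 * Δ) by ring,
    rpow_rate_eq hM hρ hε]
  ring

lemma logTerm_eq {d : ℕ} {L Δ δ c : ℝ} :
    logTerm d L M ρ ε δ Δ c = Real.log (rate d L M ρ ε Δ * d / (c ^ 5 * δ)) := by
  rw [logTerm, rate, div_mul_eq_mul_div, div_div]
  congr 2 <;> ring

lemma one_le_calP {d : ℕ} {L : ℝ} (hd : 0 < d) (hM : 0 < M) (hL : M ≤ L) : 1 ≤ calP d L M := by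
  have h1 : (1 : ℝ) ≤ d := by exact_mod_cast hd
  have h2 : 0 ≤ Real.log (2 * (d : ℝ)) := Real.log_nonneg (by linarith)
  have h3 : 0 ≤ L := hM.le.trans hL
  rw [calP]
  have : 0 ≤ L * Real.log (2 * (d : ℝ)) / M := by positivity
  linarith

/-- A unit vector in the first block forces `0 ≤ L₁`, and a vanishing maximum would force `ε ≤ 0`.
-/
lemma Assumption.lmax_pos {m n : ℕ} (hm : 0 < m) {f : Vec m n → ℝ} {L L₁ L₂ K₁ K₂ : ℝ}
    (h : Assumption f L L₁ L₂ K₁ K₂ ρ) (hε : 0 < ε)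
    (hεM : ε ≤ Lmax L₁ L₂ K₁ K₂ ^ 2 / ρ) : 0 < Lmax L₁ L₂ K₁ K₂ := by
  have h1 : 0 ≤ L₁ := by
    have h2 := (norm_nonneg _).trans
      (h.block₁ (EuclideanSpace.single (⟨0, hm⟩ : Fin m) 1) 0 0)
    simpa using h2
  have h3 : L₁ ≤ Lmax L₁ L₂ K₁ K₂ := by simp [Lmax]
  refine lt_of_le_of_ne (h1.trans h3) fun h0 => ?_
  rw [← h0] at hεM
  norm_num at hεM
  linarith

lemma mul_ceil_le {A χ c δ κ Δ G : ℝ} {d N K : ℕ} (hc : 0 < c) (hc1 : c ≤ 1) (hχ : 24 ≤ χ)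
    (hδ : 0 < δ) (hA1 : 1 ≤ 6 * A) (hN3 : 3 ≤ 3 * ((N : ℝ) + 1) / δ) (hNle : (N : ℝ) ≤ Δ / κ)
    (hΔκ : Δ / κ ≤ 2 * A * χ ^ 7 / c ^ 7) (hKdef : K = ⌈3 * ((N : ℝ) + 1) / δ⌉₊)
    (hG : G = A * d / (c ^ 5 * δ)) : (d : ℝ) * K ≤ 12 * χ ^ 7 * G / c ^ 2 := by
  have hA0 : 0 ≤ A := by linarith
  have h1 : (K : ℝ) ≤ 4 * (N + 1) / δ := by
    have h2 := Nat.ceil_lt_add_one (show 0 ≤ 3 * ((N : ℝ) + 1) / δ by positivity)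
    rw [← hKdef] at h2
    have h3 : 4 * ((N : ℝ) + 1) / δ = 3 * ((N : ℝ) + 1) / δ + (3 * ((N : ℝ) + 1) / δ) / 3 := by
      ring
    linarith
  have h4 : (N : ℝ) + 1 ≤ 3 * A * χ ^ 7 / c ^ 7 := by
    have h5 : 1 ≤ A * χ ^ 7 / c ^ 7 := by
      rw [le_div_iff₀ (by positivity), one_mul]
      calc c ^ 7 ≤ 1 := pow_le_one₀ hc.le hc1
        _ ≤ A * 24 ^ 7 := by linarith
        _ ≤ A * χ ^ 7 := by gcongr
    have h6 : 3 * A * χ ^ 7 / c ^ 7 = 2 * A * χ ^ 7 / c ^ 7 + A * χ ^ 7 / c ^ 7 := by ring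
    linarith
  calc (d : ℝ) * K ≤ d * (4 * (3 * A * χ ^ 7 / c ^ 7) / δ) := by
        gcongr
        exact h1.trans (by gcongr)
    _ = 12 * χ ^ 7 * G / c ^ 2 := by rw [hG]; field_simp; ring

/-- The bound for the total number of iterations in terms of the logarithm `ℓ`. -/
lemma total_time_le {M ρ ε γ c χ P A G ℓ : ℝ} {τ tp : ℕ} (h : Regime M ρ ε γ c χ P)
    (hAG : A / c ^ 5 ≤ G) (hlog : ℓ = Real.log G) (hχdef : χ = 6 * max ℓ 4) (hA1 : 1 ≤ 6 * A)
    (hA6 : M / γ ≤ 6 * A) (hceil : (τ : ℝ) ≤ 2 * (M * χ / (c ^ 2 * γ)))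
    (htpA : (tp : ℝ) ≤ 2 * A * χ ^ 7 / c ^ 7) : (tp : ℝ) + τ ≤ 24 ^ 8 / c ^ 7 * A * ℓ ^ 7 := by
  obtain ⟨hM, -, -, hγ, -, -, hc, hc1, -, -⟩ := h
  have hA0 : 0 ≤ A := by linarith
  have hG0 : 0 < G := lt_of_lt_of_le (div_pos (by linarith) (by positivity)) hAG
  -- From `A ≥ 1/6` and `c ≤ 1/100` the argument of the logarithm exceeds `e⁴`, so the maximum in
  -- `χ` is `ℓ` itself.
  have hℓ4 : 4 ≤ ℓ := by
    rw [hlog, Real.le_log_iff_exp_le hG0]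
    refine le_trans ?_ hAG
    rw [le_div_iff₀ (by positivity)]
    have h1 : Real.exp 4 ≤ 3 ^ 4 := by
      calc Real.exp 4 = Real.exp 1 ^ 4 := by rw [← Real.exp_nat_mul]; norm_num
        _ ≤ 3 ^ 4 := by gcongr; linarith [Real.exp_one_lt_d9]
    calc Real.exp 4 * c ^ 5 ≤ 3 ^ 4 * (1 / 100) ^ 5 := by gcongr
      _ ≤ 1 / 6 := by norm_num
      _ ≤ A := by linarith
  have hχℓ : χ = 6 * ℓ := by rw [hχdef, max_eq_left hℓ4]
  have hℓ7 : ℓ ≤ ℓ ^ 7 := le_self_pow₀ (by linarith) (by norm_num)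
  have hτle : (τ : ℝ) ≤ 72 * A * ℓ ^ 7 / c ^ 7 := by
    calc (τ : ℝ) ≤ 2 * (M * χ / (c ^ 2 * γ)) := by linarith
      _ = 12 * (M / γ) * ℓ / c ^ 2 := by rw [hχℓ]; field_simp; norm_num
      _ ≤ 12 * (6 * A) * ℓ ^ 7 / c ^ 2 := by gcongr
      _ ≤ 12 * (6 * A) * ℓ ^ 7 / c ^ 7 := by
          have : c ^ 7 ≤ c ^ 2 := pow_le_pow_of_le_one hc.le (by linarith) (by norm_num)
          gcongr
      _ = _ := by ring
  rw [hχℓ] at htpA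
  calc (tp : ℝ) + τ ≤ 2 * A * (6 * ℓ) ^ 7 / c ^ 7 + 72 * A * ℓ ^ 7 / c ^ 7 := by gcongr
    _ = (2 * 6 ^ 7 + 72) / c ^ 7 * A * ℓ ^ 7 := by ring
    _ ≤ 24 ^ 8 / c ^ 7 * A * ℓ ^ 7 := by gcongr; norm_num

end Constants

/-! ### The failure probability, and lower bounds for the gap. -/

section Probability

variable {m n : ℕ} {f : Vec m n → ℝ} {M ρ ε γ c χ P : ℝ}

/-- Pairs of an iterate at which a perturbation takes place despite a direction of negative
curvature, and of a perturbation which does not help to escape from it. -/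
def stuckSet (f : Vec m n → ℝ) (ν g φ γ b : ℝ) (τ : ℕ) : Set (Vec m n × Vec m n) :=
  {p | ‖appStep f ν p.1 - p.1‖ ≤ g / ν ∧ f p.1 ≤ b ∧ NegCurv f γ p.1 ∧
    -φ < f ((appStep f ν)^[τ] (p.1 + p.2)) - f p.1}

lemma BlockSmooth.measurableSet_stuckSet (hf : BlockSmooth f M ρ) (hb : BddBelow (Set.range f))
    {ν : ℝ} (hν : 2 * M ≤ ν) (g φ γ b : ℝ) (τ : ℕ) :
    MeasurableSet (stuckSet f ν g φ γ b τ) := by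
  have hA : Measurable (appStep f ν) := (hf.continuous_appStep hb hν).measurable
  have hAτ : Measurable (appStep f ν)^[τ] := hA.iterate τ
  have hfm : Measurable f := hf.diff.continuous.measurable
  have h1 : Measurable fun p : Vec m n × Vec m n => p.1 := measurable_fst
  exact (measurableSet_le ((hA.comp h1).sub h1).norm measurable_const).inter
    ((measurableSet_le (hfm.comp h1) measurable_const).inter
    ((h1 hf.isOpen_negCurv.measurableSet).inter
      (measurableSet_lt measurable_const
        ((hfm.comp (hAτ.comp (measurable_fst.add measurable_snd))).sub (hfm.comp h1)))))

/-- The probability that PA-PP fails is at most `3 (N + 1) / K`, where `N` bounds the number of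
iterations before the last perturbation. -/
lemma BlockSmooth.measure_fail_le (hf : BlockSmooth f M ρ) (hb : BddBelow (Set.range f))
    {x₀ : Vec m n} {ν g φ r κ : ℝ} {τ N K : ℕ} (hν : 2 * M ≤ ν) (hg : 0 < g) (hr : 0 < r)
    (hκ : 0 < κ) (hτ : 0 < τ) (hκg : κ ≤ g ^ 2 / (2 * ν)) (hκφ : κ * (τ + 1) ≤ φ)
    (hN : ∀ t : ℕ, t * κ ≤ gap f x₀ → t ≤ N) (hmn : 0 < m + n) (hK : 0 < K)
    (hthin : ∀ z e x y : Vec m n, ∀ α : ℝ, ‖appStep f ν z - z‖ ≤ g / ν → f z ≤ f x₀ → ‖e‖ = 1 →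
      ⟪e, hess f z e⟫ < -γ → ‖x‖ ≤ r → ‖y‖ ≤ r →
      -φ < f ((appStep f ν)^[τ] (z + x)) - f z → -φ < f ((appStep f ν)^[τ] (z + y)) - f z →
      y - x = α • e → α < r / ((m + n : ℕ) * K))
    {Ω : Type*} [MeasurableSpace Ω] {μ : Measure Ω} [IsProbabilityMeasure μ]
    {ξ : ℕ → Ω → Vec m n} (hξ : ∀ t, Measurable (ξ t)) (hind : iIndepFun ξ μ)
    (hunif : ∀ t, pdf.IsUniform (ξ t) (Metric.closedBall 0 r) μ volume) :
    μ {ω | ¬ ∃ (tp : ℕ) (x : Vec m n),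
      ReturnsAt f ν g φ τ (fun t => ξ t ω) x₀ (tp + τ) tp x ∧ ‖appStep f ν x - x‖ ≤ g / ν ∧
      ¬ NegCurv f γ x ∧ tp * κ ≤ gap f x₀} ≤ (N + 1) * (3 / K) := by
  have hM := hf.pos
  have hν0 : 0 < ν := by linarith
  have hA : Measurable (appStep f ν) := (hf.continuous_appStep hb hν).measurable
  let X : ℕ → (ℕ → Vec m n) → Vec m n := fun t ζ => (codeRun f ν g φ τ x₀ ζ t).2.2.1
  -- The code keeps a position even after the return, so these events may overcount; the union bound
  -- allows it.
  let B : ℕ → Set Ω := fun t =>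
    {ω | (X t (fun i => ξ i ω), ξ t ω) ∈ stuckSet f ν g φ γ (f x₀) τ}
  have hB : ∀ t, μ (B t) ≤ 3 / K := by
    intro t
    refine measure_pair_le hξ hind ?_ ?_ (hf.measurableSet_stuckSet hb hν _ _ _ _ _) ?_
    · have := measurable_codeRun (g := g) (φ := φ) (τ := τ) (x₀ := x₀) hA
        hf.diff.continuous.measurable t
      exact this.snd.snd.fst
    · intro ζ ζ' h
      simp only [X, codeRun_congr h]
    · intro z
      rw [show μ.map (ξ t) = cond volume (Metric.closedBall 0 r) from hunif t]
      by_cases hz : ‖appStep f ν z - z‖ ≤ g / ν ∧ f z ≤ f x₀ ∧ NegCurv f γ z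
      · obtain ⟨h1, h2, e, he, hneg⟩ := hz
        refine cond_closedBall_le_of_thin volume (d := m + n) (by simp) hmn hK hr he
          (measurable_prodMk_left (hf.measurableSet_stuckSet hb hν _ _ _ _ _)) ?_
        intro x hx y hy hxr hyr α hα
        exact hthin z e x y α h1 h2 he hneg hxr hyr hx.2.2.2 hy.2.2.2 hα
      · have : Prod.mk z ⁻¹' stuckSet f ν g φ γ (f x₀) τ = ∅ :=
          Set.eq_empty_of_forall_notMem fun x hx => hz ⟨hx.1, hx.2.1, hx.2.2.1⟩
        rw [this, measure_empty]
        exact zero_le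
  refine le_trans (measure_mono (t := ⋃ t ∈ Finset.range (N + 1), B t) ?_) ?_
  · intro ω hω
    by_contra hnot
    refine hω ?_
    obtain ⟨tp, x, last, hrun, hsmall, hpot, hstuck, hret⟩ :=
      exists_returnsAt (ξ := fun t => ξ t ω) (x₀ := x₀) hf hb hν0 hg hκ hτ hκg hκφ
    have h1 : ⨅ x, f x ≤ f x := ciInf_le hb x
    have h2 : tp * κ ≤ gap f x₀ := by rw [gap]; linarith
    have h3 : 0 ≤ tp * κ := by positivity
    refine ⟨tp, x, hret, hsmall, fun hneg => hnot ?_, h2⟩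
    refine Set.mem_biUnion (Finset.mem_coe.2 (Finset.mem_range_succ_iff.2 (hN tp h2))) ?_
    have hX : X tp (fun i => ξ i ω) = x := codeRun_pos_of_run hrun
    change (X tp (fun i => ξ i ω), ξ tp ω) ∈ stuckSet f ν g φ γ (f x₀) τ
    rw [hX]
    exact ⟨hsmall, by linarith, hneg, hstuck⟩
  · refine (measure_biUnion_finset_le _ _).trans ((Finset.sum_le_sum fun t _ => hB t).trans ?_)
    simp

/-- By `γ³ = Mρε` the lower bound `Mε/(6ρ)` for the gap reads `(M/γ)⁴ ≤ 6A` when `P = 1`, and a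
larger `P` only increases `A`. -/
lemma BlockSmooth.ratio_le_of_negCurv (hf : BlockSmooth f M ρ) (hb : BddBelow (Set.range f))
    (h : Regime M ρ ε γ c χ P) {x x₀ : Vec m n} (hx : NegCurv f γ x) (hle : f x ≤ f x₀) {Δ A : ℝ}
    (hΔ : Δ = gap f x₀) (hA : A = M ^ 2 * P ^ 2 * Δ / (γ * ε ^ 2)) : M / γ ≤ 6 * A := by
  have h1 := hf.gap_of_negCurv hb h hx hle
  obtain ⟨hM, hρ, hε, hγ, hγM, hγ3, -, -, -, hP⟩ := h
  have hMγ : 1 ≤ M / γ := by rwa [one_le_div hγ]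
  rw [← hΔ] at h1
  have e1 : M * ε / (6 * ρ) = M ^ 2 * ε ^ 2 / (6 * γ ^ 3) := by rw [hγ3]; field_simp
  rw [e1] at h1
  calc M / γ ≤ (M / γ) ^ 4 := le_self_pow₀ hMγ (by norm_num)
    _ = 6 * (M ^ 2 * 1 ^ 2 * (M ^ 2 * ε ^ 2 / (6 * γ ^ 3)) / (γ * ε ^ 2)) := by field_simp
    _ ≤ 6 * (M ^ 2 * P ^ 2 * Δ / (γ * ε ^ 2)) := by gcongr
    _ = 6 * A := by rw [hA]

lemma BlockSmooth.ratio_le_of_grad (hf : BlockSmooth f M ρ) (hb : BddBelow (Set.range f))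
    (h : Regime M ρ ε γ c χ P) {x₀ : Vec m n} (hlt : ε < ‖gradient f x₀‖) {Δ A : ℝ}
    (hΔ : Δ = gap f x₀) (hA : A = M ^ 2 * P ^ 2 * Δ / (γ * ε ^ 2)) : M / γ ≤ 6 * A := by
  obtain ⟨hM, hρ, hε, hγ, hγM, hγ3, -, -, -, hP⟩ := h
  have hMγ : 1 ≤ M / γ := by rwa [one_le_div hγ]
  obtain ⟨y, hy⟩ := hf.exists_le_of_grad x₀
  have h1 : ⨅ x, f x ≤ f y := ciInf_le hb y
  have h2 : ε ^ 2 / (4 * M) ≤ Δ := by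
    have : ε ^ 2 / (4 * M) ≤ ‖gradient f x₀‖ ^ 2 / (4 * M) := by gcongr
    rw [hΔ, gap]; linarith
  calc M / γ ≤ 6 / 4 * (M / γ) := by linarith
    _ = 6 * (M ^ 2 * 1 ^ 2 * (ε ^ 2 / (4 * M)) / (γ * ε ^ 2)) := by field_simp
    _ ≤ 6 * (M ^ 2 * P ^ 2 * Δ / (γ * ε ^ 2)) := by gcongr
    _ = 6 * A := by rw [hA]

end Probability

end PAPP

/-! ### Assembly of the theorem. -/

section Main

open PAPP

theorem corollary1 :
    ∃ cmax : ℝ, 0 < cmax ∧ ∃ C : ℝ, 0 < C ∧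
      ∀ (m n : ℕ), 0 < m → 0 < n →
      ∀ (f : PAPP.Vec m n → ℝ) (L L₁ L₂ K₁ K₂ ρ : ℝ),
        PAPP.Assumption f L L₁ L₂ K₁ K₂ ρ → 0 < ρ →
      ∀ M : ℝ, M = PAPP.Lmax L₁ L₂ K₁ K₂ → M ≤ L →
        BddBelow (Set.range f) →
      ∀ (x₀ : PAPP.Vec m n) (Δ : ℝ), Δ = PAPP.gap f x₀ →
      ∀ δ : ℝ, 0 < δ → δ ≤ 1 →
      ∀ ε : ℝ, 0 < ε → ε ≤ M ^ 2 / ρ →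
      ∀ c : ℝ, 0 < c → c ≤ cmax →
      ∀ (Ω : Type*) [MeasurableSpace Ω] (P : Measure Ω) [IsProbabilityMeasure P]
        (ξ : ℕ → Ω → PAPP.Vec m n),
        (∀ t, Measurable (ξ t)) →
        iIndepFun ξ P →
        (∀ t, pdf.IsUniform (ξ t)
          (Metric.closedBall 0 (PAPP.radius (m + n) L M ρ ε δ Δ c)) P volume) →
        -- the complement of the good event has probability at most `δ`
        P {ω | ¬ ∃ (T tp : ℕ) (x : PAPP.Vec m n),
            PAPP.ReturnsAt f (PAPP.nu M c) (PAPP.gth (m + n) L M ρ ε δ Δ c)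
              (PAPP.fth (m + n) L M ρ ε δ Δ c) (PAPP.tth (m + n) L M ρ ε δ Δ c)
              (fun t => ξ t ω) x₀ T tp x ∧
            PAPP.IsSS2 f ε (PAPP.gam M ρ ε) x ∧
            T = tp + PAPP.tth (m + n) L M ρ ε δ Δ c ∧
            (tp : ℝ) ≤ C / c ^ 7 * PAPP.rate (m + n) L M ρ ε Δ *
              max (PAPP.logTerm (m + n) L M ρ ε δ Δ c) 1 ^ 7 ∧
            (¬ PAPP.IsSS2 f ε (PAPP.gam M ρ ε) x₀ →
              (T : ℝ) ≤ C / c ^ 7 * PAPP.rate (m + n) L M ρ ε Δ *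
                PAPP.logTerm (m + n) L M ρ ε δ Δ c ^ 7)}
          ≤ ENNReal.ofReal δ := by
  -- The bound on `c` serves `exp_growth`; `24^8` dominates both `2 * 24^7` for `tp` and `2 * 6^7 +
  -- 72` for `T`.
  refine ⟨1 / 100, by norm_num, 24 ^ 8, by norm_num, ?_⟩
  intro m n hm hn f L L₁ L₂ K₁ K₂ ρ hass hρ M hML hL hb x₀ Δ hΔ δ hδ hδ1 ε hε hεM c hc hc1
    Ω _ P _ ξ hξ hind hunif
  have hM : 0 < M := hML ▸ hass.lmax_pos hm hε (hML ▸ hεM)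
  have hf : BlockSmooth f M ρ := hass.blockSmooth hρ hML hM
  obtain ⟨d, hd⟩ : ∃ d, d = m + n := ⟨_, rfl⟩
  have hd0 : 0 < d := by omega
  have hd1 : (1 : ℝ) ≤ d := by exact_mod_cast hd0
  rw [← hd] at hunif ⊢
  have hγ := gam_pos hM hρ hε
  have hR : Regime M ρ ε (gam M ρ ε) c (chi d L M ρ ε δ Δ c) (calP d L M) :=
    ⟨hM, hρ, hε, hγ, gam_le hM hρ hε hεM, gam_cube hM hρ hε, hc, hc1, by
      rw [chi]; linarith [le_max_right (logTerm d L M ρ ε δ Δ c) 4], one_le_calP hd0 hM hL⟩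
  have hrate := rate_eq (d := d) (L := L) (Δ := Δ) hM hρ hε
  have hlog := logTerm_eq (d := d) (L := L) (Δ := Δ) (δ := δ) (c := c) (M := M) (ρ := ρ) (ε := ε)
  have hχdef : chi d L M ρ ε δ Δ c = 6 * max (logTerm d L M ρ ε δ Δ c) 4 := rfl
  have hgdef : gth d L M ρ ε δ Δ c = c ^ 2 * ε / (chi d L M ρ ε δ Δ c ^ 3 * calP d L M) := rfl
  have hrdef : radius d L M ρ ε δ Δ c =
    c ^ 3 * ε / (chi d L M ρ ε δ Δ c ^ 3 * M * calP d L M) := rfl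
  have hφdef : fth d L M ρ ε δ Δ c =
    c ^ 5 * ε ^ 2 / (M * chi d L M ρ ε δ Δ c ^ 6 * calP d L M ^ 2) := rfl
  have hτdef : tth d L M ρ ε δ Δ c =
    ⌈M * chi d L M ρ ε δ Δ c / (c ^ 2 * gam M ρ ε)⌉₊ := rfl
  have hνdef : nu M c = M / c := rfl
  set γ := gam M ρ ε
  set χ := chi d L M ρ ε δ Δ c
  set Q := calP d L M
  set g := gth d L M ρ ε δ Δ c
  set r := radius d L M ρ ε δ Δ c
  set φ := fth d L M ρ ε δ Δ c
  set τ := tth d L M ρ ε δ Δ c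
  set ν := nu M c
  set A := rate d L M ρ ε Δ
  set ℓ := logTerm d L M ρ ε δ Δ c
  have htime := hR.time_ge
  have hceil := hR.ceil_time_le
  rw [← hτdef] at hceil
  have hτZ : M * χ / (c ^ 2 * γ) ≤ τ := by rw [hτdef]; exact Nat.le_ceil _
  have hτ0 : 0 < τ := by
    have : (0 : ℝ) < τ := by linarith
    exact_mod_cast this
  have hχ := hR.χ_ge
  have hQ := hR.P_ge
  have hγM := hR.γ_le
  have hγ3 := hR.γ_cube
  have hχ0 : 0 < χ := by linarith
  have hQ0 : 0 < Q := by linarith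
  have hφ0 : 0 < φ := by rw [hφdef]; positivity
  have hg0 : 0 < g := by rw [hgdef]; positivity
  have hr0 : 0 < r := by rw [hrdef]; positivity
  have hν2 : 2 * M ≤ ν := by rw [hνdef, le_div_iff₀ hc]; nlinarith
  have hν0 : 0 < ν := by linarith
  have hΔ0 : 0 ≤ Δ := by
    rw [hΔ, gap]; linarith [ciInf_le hb x₀]
  have hA0 : 0 ≤ A := by rw [hrate]; positivity
  have hMγ : 1 ≤ M / γ := by rwa [one_le_div hγ]
  -- the potential decreases by `κ` per iteration
  obtain ⟨κ, hκ⟩ : ∃ κ, κ = φ / (τ + 1) := ⟨_, rfl⟩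
  have hκ0 : 0 < κ := by rw [hκ]; positivity
  have hκφ : κ * (τ + 1) ≤ φ := by rw [hκ]; exact (by field_simp : _ = _).le
  have hκg : κ ≤ g ^ 2 / (2 * ν) := by
    -- A long sweep gains `φ/2`, which is at least `φ/(τ+1)` because `τ ≥ 1`.
    have e1 : g ^ 2 / (2 * ν) = φ / 2 := by rw [hgdef, hνdef, hφdef]; field_simp
    rw [e1, hκ]
    have : (1 : ℝ) ≤ τ := by exact_mod_cast hτ0
    gcongr; linarith
  have hΔκ : Δ / κ ≤ 2 * A * χ ^ 7 / c ^ 7 := by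
    calc Δ / κ = Δ * (τ + 1) / φ := by rw [hκ]; field_simp
      _ ≤ Δ * (2 * (M * χ / (c ^ 2 * γ))) / φ := by gcongr
      _ = 2 * A * χ ^ 7 / c ^ 7 := by rw [hφdef, hrate]; field_simp
  -- the argument of the logarithm
  obtain ⟨G, hG⟩ : ∃ G, G = A * d / (c ^ 5 * δ) := ⟨_, rfl⟩
  rw [← hG] at hlog
  have hAG : A / c ^ 5 ≤ G := by
    rw [hG, div_le_div_iff₀ (by positivity) (by positivity)]
    calc A * (c ^ 5 * δ) = A * c ^ 5 * δ := by ring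
      _ ≤ A * c ^ 5 * d := by gcongr; linarith
      _ = _ := by ring
  have hcpow : c ^ 5 ≤ (1 / 100) ^ 5 := by gcongr
  have hAG1 : A ≤ G := by
    refine le_trans ?_ hAG
    rw [le_div_iff₀ (by positivity)]
    exact mul_le_of_le_one_right hA0 (hcpow.trans (by norm_num))
  have hG0 : 0 ≤ G := hA0.trans hAG1
  have hGexp : G ≤ Real.exp (χ / 6) := by
    -- The case `G = 0` occurs for `Δ = 0`, where the logarithm takes its default value.
    rcases hG0.eq_or_lt with h0 | h0
    · rw [← h0]; positivity
    · rw [← Real.log_le_iff_le_exp h0, ← hlog, hχdef]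
      linarith [le_max_left ℓ 4]
  -- the failure probability
  obtain ⟨N, hNdef⟩ : ∃ N, N = ⌊Δ / κ⌋₊ := ⟨_, rfl⟩
  obtain ⟨K, hKdef⟩ : ∃ K, K = ⌈3 * ((N : ℝ) + 1) / δ⌉₊ := ⟨_, rfl⟩
  have hNle : (N : ℝ) ≤ Δ / κ := by rw [hNdef]; exact Nat.floor_le (by positivity)
  have hKge : 3 * ((N : ℝ) + 1) / δ ≤ K := by rw [hKdef]; exact Nat.le_ceil _
  have hN3 : 3 ≤ 3 * ((N : ℝ) + 1) / δ := by
    rw [le_div_iff₀ hδ]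
    have : (0 : ℝ) ≤ N := Nat.cast_nonneg N
    linarith
  have hK0' : (0 : ℝ) < K := by linarith
  have hK0 : 0 < K := by exact_mod_cast hK0'
  have hfail := hf.measure_fail_le hb (x₀ := x₀) (φ := φ) (r := r) (N := N) (K := K) (γ := γ)
    hν2 hg0 hr0 hκ0 hτ0 hκg hκφ
    (fun t ht => by
      rw [hNdef]
      exact Nat.le_floor ((le_div_iff₀ hκ0).2 (hΔ ▸ ht)))
    (by omega) hK0
    (fun z e x y α hz hzle he hneg hx hy hxs hys hα => by
      -- The bound on `M/γ` can fail in general, for instance if `Δ = 0`. Here the point `z` of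
      -- negative curvature with `f z ≤ f x₀` provides it.
      have hA6 := hf.ratio_le_of_negCurv hb hR ⟨e, he, hneg⟩ hzle hΔ hrate
      have hKd := mul_ceil_le hc (by linarith) hχ hδ (hMγ.trans hA6) hN3 hNle hΔκ hKdef hG
      rw [← hd]
      refine hf.stuck_thin hb hR (by positivity) ?_ hrdef hgdef hφdef hνdef hτdef hz he hneg.le
        hx hy hxs hys hα
      exact exp_growth hc hc1 hχ (by positivity) hGexp (by linarith) (by positivity) hKd)
    hξ hind hunif
  refine (measure_mono ?_).trans (hfail.trans ?_)
  · intro ω hω hgood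
    refine hω ?_
    obtain ⟨tp, x, hret, hsmall, hncurv, htp⟩ := hgood
    have htpA : (tp : ℝ) ≤ 2 * A * χ ^ 7 / c ^ 7 := by
      rw [← hΔ] at htp
      exact ((le_div_iff₀ hκ0).2 htp).trans hΔκ
    refine ⟨tp + τ, tp, x, hret, ⟨?_, neg_le_lambdaMin hγ.le hncurv⟩, rfl, ?_, fun hns => ?_⟩
    · calc ‖gradient f x‖ ≤ 4 * ν * ‖appStep f ν x - x‖ := hf.norm_grad_le hb hν2 x
        _ ≤ 4 * ν * (g / ν) := by gcongr
        _ = 4 * c ^ 2 / (χ ^ 3 * Q) * ε := by rw [hgdef]; field_simp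
        _ ≤ 4 * 1 ^ 2 / (24 ^ 3 * 1) * ε := by
            gcongr
            linarith
        _ ≤ ε := by linarith
    · have hχ24 : χ ≤ 24 * max ℓ 1 := by
        rw [hχdef]
        have h1 := le_max_left ℓ 1
        have h2 := le_max_right ℓ 1
        have h3 : max ℓ 4 ≤ 4 * max ℓ 1 := max_le (by linarith) (by linarith)
        linarith
      calc (tp : ℝ) ≤ 2 * A * χ ^ 7 / c ^ 7 := htpA
        _ ≤ 2 * A * (24 * max ℓ 1) ^ 7 / c ^ 7 := by gcongr
        _ = 2 * 24 ^ 7 / c ^ 7 * A * max ℓ 1 ^ 7 := by ring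
        _ ≤ 24 ^ 8 / c ^ 7 * A * max ℓ 1 ^ 7 := by gcongr; norm_num
    · have hA6 : M / γ ≤ 6 * A := by
        -- Either defect of `x₀`, a large gradient or negative curvature, bounds `Δ` from below;
        -- this lets the bound for `tp` absorb the additional `τ`.
        by_cases hgr : ε < ‖gradient f x₀‖
        · exact hf.ratio_le_of_grad hb hR hgr hΔ hrate
        · refine hf.ratio_le_of_negCurv hb hR (negCurv_of_lambdaMin_lt hγ.le ?_) le_rfl hΔ hrate
          by_contra! h
          exact hns ⟨not_lt.1 hgr, h⟩
      push_cast
      exact total_time_le hR hAG hlog hχdef (hMγ.trans hA6) hA6 (by linarith) htpA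
  · have e1 : ((N : ENNReal) + 1) * (3 / K) = ENNReal.ofReal (((N : ℝ) + 1) * (3 / K)) := by
      rw [ENNReal.ofReal_mul (by positivity), ENNReal.ofReal_div_of_pos hK0',
        ENNReal.ofReal_add (by positivity) zero_le_one]
      simp
    rw [e1]
    refine ENNReal.ofReal_le_ofReal ?_
    rw [div_le_iff₀ hδ] at hKge
    rw [mul_div_assoc', div_le_iff₀ hK0']
    linarith

end Main
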